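/- Let $\omega\in\mathbb C\setminus\mathbb R$, let $\mathbb E=\mathbb C/\langle 1,\omega\rangle$, let $A\in\mathbb Z^{d\times n}$ be an integer matrix of rank $d$ with columns $a_1,\dots,a_n$, where $a_j=(a_{j,1},\dots,a_{j,d})^T$, and let $b_1,\dots,b_n\in\mathbb R/\mathbb Z$. Consider the elliptic arrangement $\mathscr A_{\mathbb E}=\{\mathbf H_1,\dots,\mathbf H_n\}$ and the toric arrangement $\mathscr A=\{H_1,\dots,H_n\}$, where $$\mathbf H_j=\Big\{z\in\mathbb E^d \;\Big|\; \sum_k a_{j,k}z_k=b_j+\omega b_j\Big\},\qquad H_j=\Big\{x\in(\mathbb R/\mathbb Z)^d \;\Big|\; \sum_k a_{j,k}x_k=b_j\Big\},$$ and let $M(\mathscr A_{\mathbb E})=\mathbb E^d\setminus\bigcup_j\mathbf H_j$. The preimages of the $H_j$ in $\mathbb R^d$ form a $\mathbb Z^d$-periodic arrangement of hyperplanes, whose faces are polytopes and define a polyhedral cell structure on $\mathbb R^d$; its quotient by $\mathbb Z^d$ is a polyhedral CW structure on $(\mathbb R/\mathbb Z)^d$, with cells given by polytopes $P_\alpha$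 and characteristic maps $\alpha\colon P_\alpha\to(\mathbb R/\mathbb Z)^d$. Let $\mathscr F$ be its face category: objects are the cells, and morphisms $\beta\to\alpha$ are the polyhedral homeomorphisms $\varphi$ of $P_\beta$ onto a face of $P_\alpha$ with $\alpha\circ\varphi=\beta$. For a cell $F$ let $\operatorname{supp}(F)=\{H\in\mathscr A\mid F\subseteq H\}$. Let $\mathcal K$ be the full subcategory of $\mathscr F^{op}\times\mathscr F^{op}$ on the pairs $(F,G)$ with $\operatorname{supp}(F)\cap\operatorname{supp}(G)=\emptyset$. Then $\mathcal K$ is acyclic (every invertible morphism is an endomorphism, and every endomorphism is an identity), and its geometric realization $\lVert\mathcal K\rVert$ (one simplex for each chain of composable non-identity morphisms, glued along faces) is homotopy equivalent to $M(\mathscr A_{\mathbb E})$. -/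

import Mathlib

open CategoryTheory Topology
open scoped ContinuousMap

noncomputable section

namespace EllipticArrangement

/-! ### Acyclic categories and their geometric realization -/

/-- A small category is acyclic if every invertible morphism is an endomorphism and every
endomorphism is an identity. -/
structure IsAcyclicCategory (C : Type) [Category.{0} C] : Prop where
  eq_of_isIso : ∀ {X Y : C} (f : X ⟶ Y), IsIso f → X = Y
  eq_id : ∀ {X : C} (f : X ⟶ X), f = 𝟙 X

/-- A morphism of a category which is not an identity morphism. -/
def IsNonIdentity {C : Type} [Category.{0} C] {X Y : C} (f : X ⟶ Y) : Prop :=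
  ¬ ∃ h : X = Y, f = eqToHom h

/-- Chains `X₀ ⟶ X₁ ⟶ ⋯ ⟶ Xₙ` of `n` composable non-identity morphisms of `C`
(for `n = 0`: objects of `C`). A functor out of the ordered set `Fin (n + 1)` is the same thing as
`n` composable morphisms. -/
def Chain (C : Type) [Category.{0} C] (n : ℕ) : Type :=
  {γ : ComposableArrows C n //
    ∀ i : Fin n, IsNonIdentity (γ.map (homOfLE (Fin.castSucc_lt_succ (i := i)).le))}

/-- The `i`-th face of a sequence of composable morphisms: the `i`-th object is left out, and for
`0 < i < n + 1` the two morphisms that meet there are composed. -/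
def chainFace {C : Type} [Category.{0} C] {n : ℕ} (i : Fin (n + 2))
    (γ : ComposableArrows C (n + 1)) : ComposableArrows C n :=
  (Fin.succAboveOrderEmb i).monotone.functor ⋙ γ

/-- The disjoint union of one standard simplex `Δ[γ]` for each chain `γ`. -/
abbrev SimplexUnion (C : Type) [Category.{0} C] : Type :=
  Σ γ : (Σ n : ℕ, Chain C n), stdSimplex ℝ (Fin (γ.1 + 1))

/-- The elementary identifications: a point of the simplex `Δ[γᵢ]` of the `i`-th face `γᵢ` of a
chain `γ` is identified with its image in `Δ[γ]` under the inclusion of the facet opposite to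
the `i`-th vertex. -/
inductive Glue (C : Type) [Category.{0} C] : SimplexUnion C → SimplexUnion C → Prop
  | face {n : ℕ} (γ : Chain C (n + 1)) (i : Fin (n + 2)) (γ' : Chain C n)
      (h : chainFace i γ.1 = γ'.1) (x : stdSimplex ℝ (Fin (n + 1))) :
      Glue C ⟨⟨n, γ'⟩, x⟩ ⟨⟨n + 1, γ⟩, stdSimplex.map i.succAbove x⟩

/-- The geometric realization `‖C‖` of an acyclic category: one simplex for each chain of
composable non-identity morphisms, glued along faces. -/
def Realization (C : Type) [Category.{0} C] : Type := Quot (Glue C)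

instance (C : Type) [Category.{0} C] : TopologicalSpace (Realization C) :=
  inferInstanceAs (TopologicalSpace (Quot (Glue C)))

/-! ### Polyhedral cell structures and their face categories -/

/-- The data of a polyhedral cell structure on a space `K`: an index set, and for each index a
polytope `Pᵢ` with its characteristic map `Pᵢ → K`. (The face category depends on these data
only.) -/
structure PolyhedralCells (V K : Type) where
  /-- the index set of the cells -/
  Index : Type
  /-- the closed polytope of a cell -/
  polytope : Index → Set V
  /-- the characteristic map of a cell -/
  char : ∀ i, polytope i → K

/-- A face of a polytope `P` is a nonempty subset on which some linear form attains its maximum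
over `P` (the zero form gives `P` itself). -/
def IsFace {V : Type} [AddCommGroup V] [Module ℝ V] [TopologicalSpace V] (P S : Set V) : Prop :=
  S.Nonempty ∧ IsExposed ℝ P S

/-- The objects of the face category are the cells. -/
def FaceCategory {V K : Type} (X : PolyhedralCells V K) : Type := X.Index

/-- A morphism from the cell `i` to the cell `j` is a polyhedral homeomorphism `φ` of `Pᵢ` onto a
face of `Pⱼ` that is compatible with the characteristic maps. Being a polyhedral homeomorphism onto
a face of `Pⱼ` is expressed by saying that `φ` is a topological embedding into `Pⱼ` and maps every
face of `Pᵢ` (in particular `Pᵢ` itself) onto a face of `Pⱼ`: the faces of a face `F` of a polytope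
are exactly the faces of the polytope that are contained in `F`. -/
@[ext]
structure FaceHom {V K : Type} [AddCommGroup V] [Module ℝ V] [TopologicalSpace V]
    (X : PolyhedralCells V K) (i j : X.Index) : Type where
  toFun : X.polytope i → X.polytope j
  isEmbedding : IsEmbedding toFun
  map_face : ∀ S : Set V, IsFace (X.polytope i) S →
    IsFace (X.polytope j) (Subtype.val '' (toFun '' (Subtype.val ⁻¹' S)))
  comp_char : ∀ x, X.char j (toFun x) = X.char i x

instance {V K : Type} [AddCommGroup V] [Module ℝ V] [TopologicalSpace V]
    (X : PolyhedralCells V K) : Category.{0} (FaceCategory X) where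
  Hom i j := FaceHom X i j
  id i :=
    { toFun := id
      isEmbedding := IsEmbedding.id
      map_face := by
        intro S hS
        have hsub : S ⊆ X.polytope i := hS.2.subset
        simpa [Subtype.image_preimage_coe, Set.inter_eq_right.mpr hsub] using hS
      comp_char := fun _ => rfl }
  comp {i j k} f g :=
    { toFun := g.toFun ∘ f.toFun
      isEmbedding := g.isEmbedding.comp f.isEmbedding
      map_face := by
        intro S hS
        have h := g.map_face _ (f.map_face S hS)
        rw [Set.preimage_image_eq _ Subtype.val_injective] at h
        rwa [Set.image_comp]
      comp_char := fun x => (g.comp_char _).trans (f.comp_char x) }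

/-! ### Toric arrangements -/

/-- The compact torus `(S¹)ᵈ = (ℝ/ℤ)ᵈ`, written additively. -/
abbrev Torus (d : ℕ) : Type := Fin d → UnitAddCircle

/-- The universal covering `ℝᵈ → (ℝ/ℤ)ᵈ`, which is the quotient map by the group `ℤᵈ` of deck
transformations. -/
def torusProj (d : ℕ) (x : Fin d → ℝ) : Torus d := fun k => (x k : UnitAddCircle)

variable {d n : ℕ}

/-- The toric hypersurface `H_j`, defined by the `j`-th column of `A` and by `b_j`. -/
def toricHypersurface (A : Matrix (Fin d) (Fin n) ℤ) (b : Fin n → UnitAddCircle) (j : Fin n) :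
    Set (Torus d) :=
  {z | ∑ k, A k j • z k = b j}

/-- The toric arrangement, as a set of hypersurfaces. -/
def toricArrangement (A : Matrix (Fin d) (Fin n) ℤ) (b : Fin n → UnitAddCircle) :
    Set (Set (Torus d)) :=
  Set.range (toricHypersurface A b)

/-- The lift of the toric arrangement to `ℝᵈ` is the periodic arrangement of the hyperplanes
`∑ₖ A k j * x k = β`, for all `j` and all lifts `β` of `b j` to `ℝ`. Two points lie in the same
(relatively open) face of it if they lie on the same side of (or both on) each of them. -/
def SameFace (A : Matrix (Fin d) (Fin n) ℤ) (b : Fin n → UnitAddCircle) (x y : Fin d → ℝ) : Prop :=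
  ∀ (j : Fin n) (β : ℝ), (β : UnitAddCircle) = b j →
    SignType.sign (∑ k, (A k j : ℝ) * x k - β) = SignType.sign (∑ k, (A k j : ℝ) * y k - β)

/-- The (relatively open) faces of the lifted periodic hyperplane arrangement. -/
def liftedFaces (A : Matrix (Fin d) (Fin n) ℤ) (b : Fin n → UnitAddCircle) :
    Set (Set (Fin d → ℝ)) :=
  {F | ∃ x, F = {y | SameFace A b x y}}

/-- The open cells of the quotient by `ℤᵈ` of the cell complex of the lifted arrangement: the
images in the torus of the faces of the lifted arrangement. (Two faces have the same image exactly
if they lie in one `ℤᵈ`-orbit.) -/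
def toricCells (A : Matrix (Fin d) (Fin n) ℤ) (b : Fin n → UnitAddCircle) : Set (Set (Torus d)) :=
  (fun F => torusProj d '' F) '' liftedFaces A b

/-- A lift of an open cell of the torus to a face of the lifted arrangement, one for each cell. -/
def cellLift (A : Matrix (Fin d) (Fin n) ℤ) (b : Fin n → UnitAddCircle) (e : toricCells A b) :
    Set (Fin d → ℝ) :=
  e.2.choose

/-- The polyhedral cell structure on the torus induced by the toric arrangement. The polytope of a
cell is the closure of a lift of it, and its characteristic map is the restriction of the universal
covering. -/
def toricComplex (A : Matrix (Fin d) (Fin n) ℤ) (b : Fin n → UnitAddCircle) :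
    PolyhedralCells (Fin d → ℝ) (Torus d) where
  Index := toricCells A b
  polytope e := closure (cellLift A b e)
  char _ x := torusProj d x

/-- The face category of the toric arrangement. -/
abbrev ToricFaceCategory (A : Matrix (Fin d) (Fin n) ℤ) (b : Fin n → UnitAddCircle) : Type :=
  FaceCategory (toricComplex A b)

/-- The open cell in the torus given by an object of the face category. -/
def openCell (A : Matrix (Fin d) (Fin n) ℤ) (b : Fin n → UnitAddCircle)
    (F : ToricFaceCategory A b) : Set (Torus d) :=
  (show toricCells A b from F).1

/-- The support of a face: the set of all hypersurfaces of the arrangement that contain it. -/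
def supp (A : Matrix (Fin d) (Fin n) ℤ) (b : Fin n → UnitAddCircle)
    (F : ToricFaceCategory A b) : Set (Set (Torus d)) :=
  {H | H ∈ toricArrangement A b ∧ openCell A b F ⊆ H}

/-- Pairs of faces with disjoint supports. -/
def disjointSupports (A : Matrix (Fin d) (Fin n) ℤ) (b : Fin n → UnitAddCircle) :
    ObjectProperty ((ToricFaceCategory A b)ᵒᵖ × (ToricFaceCategory A b)ᵒᵖ) :=
  fun P => supp A b P.1.unop ∩ supp A b P.2.unop = ∅

/-- The category `𝒦`: pairs of faces with disjoint supports, and pairs of morphisms of the opposite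
of the face category. -/
abbrev PairCategory (A : Matrix (Fin d) (Fin n) ℤ) (b : Fin n → UnitAddCircle) : Type :=
  (disjointSupports A b).FullSubcategory

/-! ### Elliptic arrangements -/

/-- The elliptic curve `ℂ/⟨1, ω⟩`. -/
abbrev EllipticCurve (ω : ℂ) : Type := ℂ ⧸ AddSubgroup.closure ({1, ω} : Set ℂ)

/-- The homomorphism `ℝ/ℤ → ℂ/⟨1, ω⟩`, `t ↦ t + ω t`. -/
def diag (ω : ℂ) : UnitAddCircle →+ EllipticCurve ω :=
  QuotientAddGroup.map (AddSubgroup.zmultiples (1 : ℝ)) (AddSubgroup.closure ({1, ω} : Set ℂ))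
    { toFun := fun t : ℝ => (t : ℂ) + ω * (t : ℂ)
      map_zero' := by simp
      map_add' := fun s t => by push_cast; ring } (by
    rw [AddSubgroup.zmultiples_le]
    refine AddSubgroup.mem_comap.mpr ?_
    simpa using add_mem (AddSubgroup.subset_closure (by simp : (1 : ℂ) ∈ ({1, ω} : Set ℂ)))
      (AddSubgroup.subset_closure (by simp : ω ∈ ({1, ω} : Set ℂ))))

/-- The elliptic hypersurface `∑ₖ A k j zₖ = b_j + ω b_j` in the `d`-th power of the curve. -/
def ellipticHypersurface (ω : ℂ) (A : Matrix (Fin d) (Fin n) ℤ) (b : Fin n → UnitAddCircle)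
    (j : Fin n) : Set (Fin d → EllipticCurve ω) :=
  {z | ∑ k, A k j • z k = diag ω (b j)}

/-- The elliptic arrangement, as a set of hypersurfaces. -/
def ellipticArrangement (ω : ℂ) (A : Matrix (Fin d) (Fin n) ℤ) (b : Fin n → UnitAddCircle) :
    Set (Set (Fin d → EllipticCurve ω)) :=
  Set.range (ellipticHypersurface ω A b)

/-- The complement of the elliptic arrangement, with the subspace topology. -/
abbrev Complement (ω : ℂ) (A : Matrix (Fin d) (Fin n) ℤ) (b : Fin n → UnitAddCircle) : Type :=
  {z : Fin d → EllipticCurve ω // z ∉ ⋃₀ ellipticArrangement ω A b}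

end EllipticArrangement

end

noncomputable section

namespace EllipticArrangement

/-! Write `z = x + ω y` with `x`, `y` in `ℝᵈ`. Since `1` and `ω` are linearly independent over `ℝ`,
`z` lies over the `j`-th elliptic hypersurface exactly if both `x` and `y` lie over the `j`-th toric
one (`ellipticProj_mem_iff`). Hence the complement is the quotient by `ℤᵈ × ℤᵈ` of `avoidSet A b`.
This set is a union of open cells of the product subdivision of `ℝᵈ × ℝᵈ`, and with a cell it
contains every cell that has it as a face. Such a set deformation retracts onto the part of the
barycentric subdivision spanned by its own cells: drop the barycentric coordinates of the other
cells, rescale, and move along straight segments (`FaceSystem.continuous_retract`,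
`FaceSystem.segment_mem`).

The combinatorial side is a quotient by the same group. Morphisms of the face category are integer
translations of one closed face into another (`FaceHom.exists_vec`, `FaceHom.ofVec`), so the pair
category is the quotient of the poset `LiftedPair A b` by translations, and its chains lift to
strict chains (`projChain_liftChain`). The action is free because the cells are bounded, which is
where the rank condition enters (`eq_zero_of_faceRel_add`); this also gives acyclicity. The
retraction and the straight-line homotopy commute with translations (`FaceSystem.desc_add`), hence
descend to the quotients. One composite of the resulting maps is the identity, the other is
homotopic to it.

The subdivision is handled through a relation between points (`FaceOrder`), whose axioms for the
arrangement reduce, via affine height functions, to the line cut at the integers. Barycentric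
coordinates exist by repeated radial projection to the boundary of a cell
(`FaceSystem.exists_chain`) and are unique (`FaceSystem.chainWeight_unique`); continuity is checked
simplex by simplex, using local finiteness. -/

/-! ### Polyhedral subdivisions given by a preorder on points -/

/-- The properties of the relation "`x` lies in the closure of the open cell of `y`" for a locally
finite decomposition of a vector space into relatively open cells of bounded size which is cut out
by affine hyperplanes. -/
structure FaceOrder {E : Type*} [NormedAddCommGroup E] [NormedSpace ℝ E]
    (r : E → E → Prop) : Prop where
  refl : ∀ x, r x x
  trans : ∀ {x y z}, r x y → r y z → r x z
  convex : ∀ z, Convex ℝ {x | r x z}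
  interior : ∀ {x y}, r x y → ∀ t : ℝ, 0 < t → t ≤ 1 → r y ((1 - t) • x + t • y)
  isClosed : ∀ z, IsClosed {x | r x z}
  eventually : ∀ x, ∀ᶠ y in 𝓝 x, r x y
  -- The line through two points of one open cell lies in the affine hull of that cell, so a point
  -- on it cannot belong to a strictly larger cell.
  extend : ∀ {p y} (u : ℝ), r y p → r p y → r y (p + u • (y - p)) → r (p + u • (y - p)) y
  bounded : ∃ D : ℝ, ∀ x y, r x y → dist x y ≤ D

/-- A choice of one point in each open cell. The cells are ordered by reverse inclusion of their
closures, as in the opposite of the face category. -/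
structure FaceSystem {E : Type*} [NormedAddCommGroup E] [NormedSpace ℝ E]
    (r : E → E → Prop) {Q : Type*} [PartialOrder Q] (p : Q → E) : Prop where
  le_iff : ∀ a b, a ≤ b ↔ r (p b) (p a)
  surj : ∀ x, ∃ q, r (p q) x ∧ r x (p q)
  finite : ∀ x D, {q | dist (p q) x ≤ D}.Finite

section Subdivision

variable {E : Type*} [NormedAddCommGroup E] [NormedSpace ℝ E] {r : E → E → Prop}

/-- The ray from an interior point of a cell through another one leaves the cell through a proper
face. -/
theorem FaceOrder.exists_exit (hr : FaceOrder r) {p x : E} (hxp : r x p) (hpx : r p x)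
    (hne : x ≠ p) : ∃ y, ∃ t : ℝ, 0 < t ∧ t < 1 ∧ r y x ∧ ¬ r x y ∧ x = (1 - t) • p + t • y := by
  obtain ⟨D, hD⟩ := hr.bounded
  have hn : 0 < ‖x - p‖ := norm_pos_iff.mpr (sub_ne_zero.mpr hne)
  set z : ℝ → E := fun u => p + u • (x - p) with hz
  have hzc : Continuous z := by fun_prop
  have hz1 : z 1 = x := by simp [hz]
  set U : Set ℝ := {u | r (z u) x} with hU
  have hUc : IsClosed U := (hr.isClosed x).preimage hzc
  have h1 : (1 : ℝ) ∈ U := by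
    change r (z 1) x
    rw [hz1]
    exact hr.refl x
  have hUb : BddAbove U := by
    refine ⟨1 + D / ‖x - p‖, fun u hu => ?_⟩
    have h := hD _ _ hu
    have : z u - x = (u - 1) • (x - p) := by simp only [hz]; module
    rw [dist_eq_norm, this, norm_smul, Real.norm_eq_abs] at h
    have h' : (u - 1) * ‖x - p‖ ≤ D :=
      (mul_le_mul_of_nonneg_right (le_abs_self _) hn.le).trans h
    rw [← le_div_iff₀ hn] at h'
    linarith
  have hs : sSup U ∈ U := hUc.csSup_mem ⟨1, h1⟩ hUb
  set u := sSup U with hu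
  have hu1 : 1 ≤ u := le_csSup hUb h1
  -- At the last parameter the ray has left the open cell: otherwise `eventually` and `extend` would
  -- put slightly larger parameters into `U`.
  have hnr : ¬ r x (z u) := by
    intro h
    have h2 : ∀ᶠ v in 𝓝 u, r (z u) (z v) := hzc.continuousAt.eventually (hr.eventually (z u))
    obtain ⟨v, hv, huv⟩ := ((h2.filter_mono nhdsWithin_le_nhds).and
      (self_mem_nhdsWithin : Set.Ioi u ∈ 𝓝[>] u)).exists
    have h3 : v ∈ U := hr.extend v hxp hpx (hr.trans h hv)
    exact absurd (le_csSup hUb h3) (not_le.mpr huv)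
  have hu1' : 1 < u := lt_of_le_of_ne hu1 (by
    intro h
    rw [← h, hz1] at hnr
    exact hnr (hr.refl x))
  have hu0 : u ≠ 0 := by positivity
  refine ⟨z u, u⁻¹, by positivity, inv_lt_one_of_one_lt₀ hu1', hs, hnr, ?_⟩
  simp only [hz]
  rw [smul_add, smul_smul, inv_mul_cancel₀ hu0]
  module

/-! ### Barycentric coordinates with respect to the chosen points of the cells. -/

variable {Q : Type*}

/-- The total mass of a finitely supported weight. -/
def totalMass : (Q →₀ ℝ) →ₗ[ℝ] ℝ := Finsupp.linearCombination ℝ (fun _ : Q => (1 : ℝ))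

theorem totalMass_eq_sum (W : Q →₀ ℝ) : totalMass W = ∑ q ∈ W.support, W q := by
  simp [totalMass, Finsupp.linearCombination_apply, Finsupp.sum]

/-- The weight on `Q` given by coefficients of a finite family of elements. -/
def chainWeight {k : ℕ} (σ : Fin (k + 1) → Q) (t : Fin (k + 1) → ℝ) : Q →₀ ℝ :=
  ∑ i, Finsupp.single (σ i) (t i)

theorem linearCombination_chainWeight {M : Type*} [AddCommGroup M] [Module ℝ M] (p : Q → M)
    {k : ℕ} (σ : Fin (k + 1) → Q) (t : Fin (k + 1) → ℝ) :
    Finsupp.linearCombination ℝ p (chainWeight σ t) = ∑ i, t i • p (σ i) := by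
  simp [chainWeight, map_sum]

theorem totalMass_chainWeight {k : ℕ} (σ : Fin (k + 1) → Q) (t : Fin (k + 1) → ℝ) :
    totalMass (chainWeight σ t) = ∑ i, t i := by
  simp [totalMass, linearCombination_chainWeight]

theorem chainWeight_apply {k : ℕ} {σ : Fin (k + 1) → Q} (hσ : Function.Injective σ)
    (t : Fin (k + 1) → ℝ) (i : Fin (k + 1)) : chainWeight σ t (σ i) = t i := by
  classical
  simp [chainWeight, Finsupp.finsetSum_apply, Finsupp.single_apply, hσ.eq_iff]

theorem chainWeight_nonneg {k : ℕ} (σ : Fin (k + 1) → Q) {t : Fin (k + 1) → ℝ}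
    (ht : ∀ i, 0 ≤ t i) (q : Q) : 0 ≤ chainWeight σ t q := by
  classical
  rw [chainWeight, Finsupp.finsetSum_apply]
  refine Finset.sum_nonneg fun i _ => ?_
  rw [Finsupp.single_apply]
  split_ifs
  exacts [ht i, le_rfl]

theorem support_chainWeight_subset {k : ℕ} (σ : Fin (k + 1) → Q) (t : Fin (k + 1) → ℝ) :
    ((chainWeight σ t).support : Set Q) ⊆ Set.range σ := by
  classical
  intro q hq
  by_contra h
  refine (Finsupp.mem_support_iff.mp hq) ?_
  rw [chainWeight, Finsupp.finsetSum_apply]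
  refine Finset.sum_eq_zero fun i _ => ?_
  rw [Finsupp.single_apply, if_neg]
  exact fun hi => h ⟨i, hi⟩

variable [PartialOrder Q]

/-- Barycentric coordinates: nonnegative weights of total mass one that are supported on a chain. -/
structure IsChainWeight (W : Q →₀ ℝ) : Prop where
  nonneg : ∀ q, 0 ≤ W q
  total : totalMass W = 1
  chain : IsChain (· ≤ ·) (W.support : Set Q)

theorem isChainWeight_chainWeight {k : ℕ} {σ : Fin (k + 1) → Q} (hσ : StrictMono σ)
    (t : stdSimplex ℝ (Fin (k + 1))) : IsChainWeight (chainWeight σ t) where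
  nonneg := chainWeight_nonneg σ (fun i => t.2.1 i)
  total := by rw [totalMass_chainWeight]; exact t.2.2
  chain := by
    refine IsChain.mono (support_chainWeight_subset σ t) ?_
    rintro _ ⟨i, rfl⟩ _ ⟨j, rfl⟩ _
    exact (le_total i j).imp (fun h => hσ.monotone h) (fun h => hσ.monotone h)

theorem exists_least_of_isChain {s : Finset Q} (hs : s.Nonempty)
    (hc : IsChain (· ≤ ·) (s : Set Q)) : ∃ q ∈ s, ∀ q' ∈ s, q ≤ q' := by
  obtain ⟨q, hq, hmin⟩ := s.exists_minimal hs
  refine ⟨q, hq, fun q' hq' => ?_⟩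
  rcases hc.total hq hq' with h | h
  exacts [h, hmin hq' h]

variable {p : Q → E}

/-- The order reverses inclusion, so `q` is the largest cell involved: its closed cell contains all
the points being combined, and the positive weight at `q` pushes the combination into the open cell.
-/
theorem FaceSystem.linearCombination_mem_cell (hr : FaceOrder r) (hp : FaceSystem r p)
    {W : Q →₀ ℝ} (h0 : ∀ q, 0 ≤ W q) (h1 : totalMass W = 1) {q : Q} (hq : 0 < W q)
    (hmin : ∀ q' ∈ W.support, q ≤ q') :
    r (Finsupp.linearCombination ℝ p W) (p q) ∧ r (p q) (Finsupp.linearCombination ℝ p W) := by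
  classical
  rw [totalMass_eq_sum] at h1
  have hle : ∀ q' ∈ W.support, r (p q') (p q) := fun q' h => (hp.le_iff _ _).mp (hmin q' h)
  have hqs : q ∈ W.support := Finsupp.mem_support_iff.mpr hq.ne'
  rw [Finsupp.linearCombination_apply, Finsupp.sum]
  refine ⟨(hr.convex (p q)).sum_mem (fun i _ => h0 i) h1 hle, ?_⟩
  rw [← Finset.add_sum_erase _ _ hqs] at h1 ⊢
  have hE0 : ∀ i ∈ W.support.erase q, 0 ≤ W i := fun i _ => h0 i
  -- Otherwise the remaining weights can be rescaled by `(1 - W q)⁻¹`, and the combination lies on a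
  -- segment from their barycenter to `p q`.
  by_cases hq1 : W q = 1
  · have hz : ∑ i ∈ W.support.erase q, W i = 0 := by linarith
    rw [Finset.sum_eq_zero_iff_of_nonneg hE0] at hz
    rw [Finset.sum_eq_zero (s := W.support.erase q) (fun i hi => by rw [hz i hi, zero_smul]),
      hq1, one_smul, add_zero]
    exact hr.refl _
  · have hs := Finset.sum_nonneg hE0
    have hlt : 0 < 1 - W q := by
      rcases lt_or_eq_of_le (show W q ≤ 1 by linarith) with h | h
      · linarith
      · exact absurd h hq1
    have hy := (hr.convex (p q)).sum_mem (t := W.support.erase q)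
      (w := fun i => (1 - W q)⁻¹ * W i) (z := p)
      (fun i _ => mul_nonneg (inv_nonneg.mpr hlt.le) (h0 i))
      (by rw [← Finset.mul_sum, show ∑ i ∈ W.support.erase q, W i = 1 - W q by linarith,
            inv_mul_cancel₀ hlt.ne'])
      (fun i hi => hle i (Finset.mem_of_mem_erase hi))
    have h := hr.interior hy (W q) hq (by linarith)
    simp_rw [mul_smul] at h
    rwa [← Finset.smul_sum, smul_smul, mul_inv_cancel₀ hlt.ne', one_smul, add_comm] at h

theorem IsChainWeight.exists_top {W : Q →₀ ℝ} (hW : IsChainWeight W) :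
    ∃ q, 0 < W q ∧ ∀ q' ∈ W.support, q ≤ q' := by
  have hne : W.support.Nonempty := by
    by_contra h
    rw [Finset.not_nonempty_iff_eq_empty] at h
    have := hW.total
    rw [totalMass_eq_sum, h] at this
    simp at this
  obtain ⟨q, hq, hmin⟩ := exists_least_of_isChain hne hW.chain
  exact ⟨q, lt_of_le_of_ne (hW.nonneg q) (Ne.symm (Finsupp.mem_support_iff.mp hq)), hmin⟩

/-- A point has at most one system of barycentric coordinates. -/
theorem FaceSystem.chainWeight_unique (hr : FaceOrder r) (hp : FaceSystem r p) {W W' : Q →₀ ℝ}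
    (hW : IsChainWeight W) (hW' : IsChainWeight W')
    (h : Finsupp.linearCombination ℝ p W = Finsupp.linearCombination ℝ p W') : W = W' := by
  classical
  -- Removing the common part leaves two weights of equal mass and equal combination which are
  -- nowhere both positive.
  set u := W ⊓ W' with hu
  have hua : ∀ q, u q = min (W q) (W' q) := fun q => rfl
  have hmass : totalMass (W - u) = totalMass (W' - u) := by
    rw [map_sub, map_sub, hW.total, hW'.total]
  have hcomb : Finsupp.linearCombination ℝ p (W - u) = Finsupp.linearCombination ℝ p (W' - u) := by
    rw [map_sub, map_sub, h]
  have key : ∀ V V' : Q →₀ ℝ, IsChainWeight V → (∀ q, min (V q) (V' q) = u q) →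
      0 < totalMass (V - u) → ∃ q, u q < V q ∧
        r (Finsupp.linearCombination ℝ p ((totalMass (V - u))⁻¹ • (V - u))) (p q) ∧
        r (p q) (Finsupp.linearCombination ℝ p ((totalMass (V - u))⁻¹ • (V - u))) := by
    intro V V' hV hVu hm
    have hpos : ∀ q, 0 ≤ (V - u) q := fun q => by
      rw [Finsupp.sub_apply, ← hVu q]; exact sub_nonneg.mpr (min_le_left _ _)
    set m := totalMass (V - u)
    have hsupp : (m⁻¹ • (V - u)).support = (V - u).support :=
      Finsupp.support_smul_eq (inv_ne_zero hm.ne')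
    have hsub : ((V - u).support : Set Q) ⊆ V.support := by
      intro q hq
      rw [Finset.mem_coe, Finsupp.mem_support_iff] at hq ⊢
      intro h0
      apply hq
      have h1 := hpos q
      have h2 : 0 ≤ min (W q) (W' q) := le_min (hW.nonneg q) (hW'.nonneg q)
      rw [← hua q] at h2
      rw [Finsupp.sub_apply] at h1 ⊢
      linarith
    have hC : IsChainWeight (m⁻¹ • (V - u)) :=
      { nonneg := fun q => by
          rw [Finsupp.smul_apply, smul_eq_mul]
          exact mul_nonneg (inv_nonneg.mpr hm.le) (hpos q)
        total := by rw [map_smul, smul_eq_mul]; exact inv_mul_cancel₀ hm.ne'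
        chain := by rw [hsupp]; exact hV.chain.mono hsub }
    obtain ⟨q, hq, hmin⟩ := hC.exists_top
    refine ⟨q, ?_, hp.linearCombination_mem_cell hr hC.nonneg hC.total hq hmin⟩
    rw [Finsupp.smul_apply, smul_eq_mul, Finsupp.sub_apply] at hq
    have := pos_of_mul_pos_right hq (inv_nonneg.mpr hm.le)
    linarith
  have hnn : ∀ q, 0 ≤ (W - u) q := fun q => by
    rw [Finsupp.sub_apply, hua]; exact sub_nonneg.mpr (min_le_left _ _)
  have hnn' : ∀ q, 0 ≤ (W' - u) q := fun q => by
    rw [Finsupp.sub_apply, hua]; exact sub_nonneg.mpr (min_le_right _ _)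
  have hz : ∀ V : Q →₀ ℝ, (∀ q, 0 ≤ V q) → totalMass V = 0 → V = 0 := by
    intro V hV h0
    rw [totalMass_eq_sum, Finset.sum_eq_zero_iff_of_nonneg (fun i _ => hV i)] at h0
    ext q
    by_cases hq : q ∈ V.support
    · exact h0 q hq
    · simpa using hq
  rcases (show 0 ≤ totalMass (W - u) by
    rw [totalMass_eq_sum]; exact Finset.sum_nonneg fun i _ => hnn i).eq_or_lt with h0 | h0
  · have h1 := hz _ hnn h0.symm
    have h2 := hz _ hnn' (hmass ▸ h0.symm)
    rw [sub_eq_zero] at h1 h2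
    rw [h1, h2]
  · obtain ⟨q, hq, hq1, hq2⟩ := key W W' hW (fun q => (hua q).symm) h0
    obtain ⟨q', hq', hq1', hq2'⟩ := key W' W hW' (fun q => by rw [min_comm]; exact (hua q).symm)
      (hmass ▸ h0)
    rw [← hmass, map_smul, ← hcomb, ← map_smul] at hq1' hq2'
    -- If mass remains, both rescaled remainders represent one point, so the largest cells of their
    -- supports agree, although the remainders have no common support.
    have : q = q' := le_antisymm ((hp.le_iff _ _).mpr (hr.trans hq2' hq1))
      ((hp.le_iff _ _).mpr (hr.trans hq2 hq1'))
    subst this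
    rw [hua] at hq hq'
    exact absurd (lt_min hq hq') (lt_irrefl _)

theorem FaceSystem.finite_le (hr : FaceOrder r) (hp : FaceSystem r p) (x : E) :
    {q | r (p q) x}.Finite := by
  obtain ⟨D, hD⟩ := hr.bounded
  exact (hp.finite x D).subset fun q hq => hD _ _ hq

/-- Every point has barycentric coordinates. -/
theorem FaceSystem.exists_chain (hr : FaceOrder r) (hp : FaceSystem r p) (x : E) :
    ∃ (k : ℕ) (σ : Fin (k + 1) → Q) (_ : StrictMono σ) (t : stdSimplex ℝ (Fin (k + 1))),
      (∀ i, r (p (σ i)) x) ∧ ∑ i, t i • p (σ i) = x := by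
  -- The induction is on the number of faces of the closed cell of `x`; projecting `x` away from the
  -- chosen point of its cell onto the boundary lowers it.
  induction hN : {q | r (p q) x}.ncard using Nat.strong_induction_on generalizing x with
  | _ N ih =>
    subst hN
    obtain ⟨q, hqx, hxq⟩ := hp.surj x
    by_cases hx : x = p q
    · refine ⟨0, fun _ => q, fun i j h => by omega, ⟨fun _ => 1, by simp [stdSimplex]⟩,
        fun _ => hqx, ?_⟩
      rw [hx]
      simp [DFunLike.coe]
    · obtain ⟨y, s, hs0, hs1, hyx, hxy, hxe⟩ := hr.exists_exit hxq hqx hx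
      have hlt : {q | r (p q) y}.ncard < {q | r (p q) x}.ncard := by
        refine Set.ncard_lt_ncard ?_ (hp.finite_le hr x)
        refine ⟨fun q' h => hr.trans h hyx, fun h => ?_⟩
        exact hxy (hr.trans hxq (h hqx))
      obtain ⟨k, σ, hσ, t, hσy, hty⟩ := ih _ hlt y rfl
      refine ⟨k + 1, Fin.cons q σ, ?_, ⟨Fin.cons (1 - s) (fun i => s * t i), ?_, ?_⟩, ?_, ?_⟩
      · rw [Fin.strictMono_iff_lt_succ]
        intro i
        refine Fin.cases ?_ (fun j => ?_) i
        · simp only [Fin.castSucc_zero, Fin.cons_zero, Fin.cons_succ]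
          refine lt_of_le_not_ge ((hp.le_iff _ _).mpr
            (hr.trans (hσy 0) (hr.trans hyx hxq))) fun h => ?_
          exact hxy (hr.trans hxq (hr.trans ((hp.le_iff _ _).mp h) (hσy 0)))
        · simp only [← Fin.succ_castSucc, Fin.cons_succ]
          exact hσ Fin.castSucc_lt_succ
      · intro i
        refine Fin.cases ?_ (fun j => ?_) i
        · simp only [Fin.cons_zero]; linarith
        · simp only [Fin.cons_succ]
          exact mul_nonneg hs0.le (t.2.1 j)
      · have := t.2.2
        rw [Fin.sum_univ_succ]
        simp only [Fin.cons_zero, Fin.cons_succ]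
        rw [← Finset.mul_sum]
        erw [this]
        ring
      · intro i
        refine Fin.cases ?_ (fun j => ?_) i
        · exact hqx
        · simp only [Fin.cons_succ]; exact hr.trans (hσy j) hyx
      · rw [Fin.sum_univ_succ]
        simp only [DFunLike.coe, Fin.cons_zero, Fin.cons_succ]
        rw [hxe, ← hty, Finset.smul_sum]
        simp only [DFunLike.coe, mul_smul]

end Subdivision

/-! ### Continuity with respect to a locally finite family of closed maps -/

/-- The preimage of a closed set is a locally finite union of images of closed sets. Asking for
closed maps rather than compact sources allows the pieces to be the parts of simplices that lie in a
non-closed set. -/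
theorem continuous_of_locallyFinite_isClosedMap {ι X Y : Type*} {K : ι → Type*}
    [TopologicalSpace X] [TopologicalSpace Y] [∀ i, TopologicalSpace (K i)] {ψ : ∀ i, K i → X}
    (hcl : ∀ i, IsClosedMap (ψ i)) (hlf : LocallyFinite fun i => Set.range (ψ i))
    (hcov : ∀ x, ∃ i y, ψ i y = x) {g : X → Y} (hg : ∀ i, Continuous fun y => g (ψ i y)) :
    Continuous g := by
  rw [continuous_iff_isClosed]
  intro C hC
  have h : g ⁻¹' C = ⋃ i, ψ i '' ((fun y => g (ψ i y)) ⁻¹' C) := by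
    ext x
    simp only [Set.mem_preimage, Set.mem_iUnion, Set.mem_image]
    constructor
    · intro hx
      obtain ⟨i, y, rfl⟩ := hcov x
      exact ⟨i, y, hx, rfl⟩
    · rintro ⟨i, y, hy, rfl⟩
      exact hy
  rw [h]
  exact (hlf.subset fun i => Set.image_subset_range _ _).isClosed_iUnion
    fun i => hcl i _ (hC.preimage (hg i))

/-! ### Points of a glued space given by chains with weights -/

/-- A family of continuous maps from simplices, one for each strict chain, that is compatible with
the face inclusions. -/
structure IsChainMap {Q T : Type*} [PartialOrder Q] [TopologicalSpace T]
    (cls : ∀ (k : ℕ) (σ : Fin (k + 1) → Q), StrictMono σ → stdSimplex ℝ (Fin (k + 1)) → T) :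
    Prop where
  continuous : ∀ k σ hσ, Continuous (cls k σ hσ)
  face : ∀ (k : ℕ) (σ : Fin (k + 2) → Q) (hσ : StrictMono σ) (i : Fin (k + 2))
    (t : stdSimplex ℝ (Fin (k + 1))), cls (k + 1) σ hσ (stdSimplex.map i.succAbove t) =
      cls k (σ ∘ i.succAbove) (hσ.comp (Fin.strictMono_succAbove i)) t

theorem stdSimplex_map_succAbove_self {k : ℕ} (i : Fin (k + 2))
    (t : stdSimplex ℝ (Fin (k + 1))) : stdSimplex.map i.succAbove t i = 0 := by
  classical
  rw [stdSimplex.map_coe, FunOnFinite.linearMap_apply_apply]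
  exact Finset.sum_eq_zero fun j hj => absurd (Finset.mem_filter.mp hj).2 (Fin.succAbove_ne i j)

theorem stdSimplex_map_succAbove_succAbove {k : ℕ} (i : Fin (k + 2)) (j : Fin (k + 1))
    (t : stdSimplex ℝ (Fin (k + 1))) : stdSimplex.map i.succAbove t (i.succAbove j) = t j := by
  classical
  rw [stdSimplex.map_coe, FunOnFinite.linearMap_apply_apply]
  rw [Finset.sum_eq_single j]
  · intro b hb hbj
    exact absurd (Fin.succAbove_right_injective (Finset.mem_filter.mp hb).2) hbj
  · simp

theorem exists_stdSimplex_map_succAbove {k : ℕ} (i : Fin (k + 2)) (t : stdSimplex ℝ (Fin (k + 2)))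
    (hi : t i = 0) : ∃ t' : stdSimplex ℝ (Fin (k + 1)), t = stdSimplex.map i.succAbove t' := by
  refine ⟨⟨fun j => t (i.succAbove j), fun j => t.2.1 _, ?_⟩, ?_⟩
  · have h : ∑ j, t j = 1 := t.2.2
    rwa [Fin.sum_univ_succAbove _ i, hi, zero_add] at h
  · ext j
    rcases Fin.eq_self_or_eq_succAbove i j with rfl | ⟨j, rfl⟩
    · rw [stdSimplex_map_succAbove_self, hi]
    · rw [stdSimplex_map_succAbove_succAbove]; rfl

theorem sum_stdSimplex_map_succAbove {M : Type*} [AddCommGroup M] [Module ℝ M] {k : ℕ}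
    (i : Fin (k + 2)) (t : stdSimplex ℝ (Fin (k + 1))) (f : Fin (k + 2) → M) :
    ∑ j, stdSimplex.map i.succAbove t j • f j = ∑ j, t j • f (i.succAbove j) := by
  rw [Fin.sum_univ_succAbove _ i, stdSimplex_map_succAbove_self, zero_smul, zero_add]
  simp_rw [stdSimplex_map_succAbove_succAbove]

theorem chainWeight_eq_sum {Q : Type*} {k : ℕ} (σ : Fin (k + 1) → Q) (t : Fin (k + 1) → ℝ) :
    chainWeight σ t = ∑ i, t i • Finsupp.single (σ i) (1 : ℝ) := by
  simp [chainWeight]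

section ChainMap

variable {Q T : Type*} [PartialOrder Q] [TopologicalSpace T]
  {cls : ∀ (k : ℕ) (σ : Fin (k + 1) → Q), StrictMono σ → stdSimplex ℝ (Fin (k + 1)) → T}

/-- Vertices of weight zero can be dropped one at a time: the face relation keeps the image, and the
weight on `Q` is unchanged. -/
theorem IsChainMap.exists_pos (hc : IsChainMap cls) (k : ℕ) (σ : Fin (k + 1) → Q)
    (hσ : StrictMono σ) (t : stdSimplex ℝ (Fin (k + 1))) :
    ∃ (k' : ℕ) (σ' : Fin (k' + 1) → Q) (hσ' : StrictMono σ') (t' : stdSimplex ℝ (Fin (k' + 1))),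
      (∀ i, 0 < t' i) ∧ cls k' σ' hσ' t' = cls k σ hσ t ∧ chainWeight σ' t' = chainWeight σ t := by
  induction k with
  | zero =>
    refine ⟨0, σ, hσ, t, fun i => ?_, rfl, rfl⟩
    have h : ∑ j, t j = 1 := t.2.2
    have hi : i = 0 := by omega
    subst hi
    rw [Fin.sum_univ_one] at h
    rw [h]
    exact one_pos
  | succ k ih =>
    by_cases h : ∃ i, t i = 0
    · obtain ⟨i, hi⟩ := h
      obtain ⟨t', rfl⟩ := exists_stdSimplex_map_succAbove i t hi
      obtain ⟨k', σ', hσ', t'', h1, h2, h3⟩ := ih _ (hσ.comp (Fin.strictMono_succAbove i)) t'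
      refine ⟨k', σ', hσ', t'', h1, h2.trans (hc.face k σ hσ i t').symm, h3.trans ?_⟩
      rw [chainWeight_eq_sum, chainWeight_eq_sum, sum_stdSimplex_map_succAbove]
      rfl
    · push Not at h
      exact ⟨k + 1, σ, hσ, t, fun i => lt_of_le_of_ne (t.2.1 i) (Ne.symm (h i)), rfl, rfl⟩

/-- The image of a point under a chain map depends on the weights only. -/
theorem IsChainMap.eq_of_chainWeight_eq (hc : IsChainMap cls) {k l : ℕ} {σ : Fin (k + 1) → Q}
    {τ : Fin (l + 1) → Q} (hσ : StrictMono σ) (hτ : StrictMono τ)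
    {s : stdSimplex ℝ (Fin (k + 1))} {t : stdSimplex ℝ (Fin (l + 1))}
    (h : chainWeight σ s = chainWeight τ t) : cls k σ hσ s = cls l τ hτ t := by
  classical
  obtain ⟨k', σ', hσ', s', hs1, hs2, hs3⟩ := hc.exists_pos k σ hσ s
  obtain ⟨l', τ', hτ', t', ht1, ht2, ht3⟩ := hc.exists_pos l τ hτ t
  rw [← hs2, ← ht2]
  rw [← hs3, ← ht3] at h
  have hsupp : ∀ (m : ℕ) (ρ : Fin (m + 1) → Q) (_ : StrictMono ρ) (u : stdSimplex ℝ (Fin (m + 1))),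
      (∀ i, 0 < u i) → ((chainWeight ρ u).support : Set Q) = Set.range ρ := by
    intro m ρ hρ u hu
    refine (support_chainWeight_subset ρ u).antisymm ?_
    rintro _ ⟨i, rfl⟩
    rw [Finset.mem_coe, Finsupp.mem_support_iff, chainWeight_apply hρ.injective]
    exact (hu i).ne'
  -- With positive coefficients the weight determines the vertex set, and a strict chain is
  -- determined by its vertex set.
  have hrange : Set.range σ' = Set.range τ' := by
    rw [← hsupp _ σ' hσ' s' hs1, ← hsupp _ τ' hτ' t' ht1, h]
  have hcard : k' = l' := by
    have h1 := Set.ncard_range_of_injective hσ'.injective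
    have h2 := Set.ncard_range_of_injective hτ'.injective
    rw [hrange, h2] at h1
    simpa using h1.symm
  subst hcard
  have hστ : σ' = τ' := (hσ'.range_inj hτ').mp hrange
  subst hστ
  congr 1
  ext i
  have := congrArg (fun W => W (σ' i)) h
  simpa only [chainWeight_apply hσ'.injective] using this

end ChainMap

/-! ### Truncating weights to an initial segment of a chain. -/

theorem sum_fin_ite_le {N : Type*} [AddCommMonoid N] {m k : ℕ} (hm : m + 1 ≤ k + 1)
    (f : Fin (k + 1) → N) :
    (∑ i : Fin (k + 1), if (i : ℕ) ≤ m then f i else 0) = ∑ j : Fin (m + 1), f (Fin.castLE hm j) := by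
  symm
  refine Finset.sum_of_injOn (Fin.castLE hm) ((Fin.castLE_injective hm).injOn)
    (fun _ _ => by simp) ?_ ?_
  · intro i _ hi
    rw [if_neg]
    intro him
    exact hi ⟨⟨i, by omega⟩, by simp, rfl⟩
  · intro j _
    rw [if_pos]
    simp only [Fin.val_castLE]
    omega

theorem filter_chainWeight {E Q : Type*} {p : Q → E} {M : Set E} {m k : ℕ} (hm : m + 1 ≤ k + 1) {σ : Fin (k + 1) → Q}
    (h : ∀ i, p (σ i) ∈ M ↔ (i : ℕ) ≤ m) (t : Fin (k + 1) → ℝ)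
    [DecidablePred fun q => p q ∈ M] :
    (chainWeight σ t).filter (fun q => p q ∈ M) =
      chainWeight (fun j => σ (Fin.castLE hm j)) (fun j => t (Fin.castLE hm j)) := by
  rw [chainWeight, Finsupp.filter_sum, chainWeight,
    ← sum_fin_ite_le hm (fun i => Finsupp.single (σ i) (t i))]
  refine Finset.sum_congr rfl fun i _ => ?_
  by_cases hi : p (σ i) ∈ M
  · rw [Finsupp.filter_single_of_pos (fun q => p q ∈ M) hi, if_pos ((h i).mp hi)]
  · rw [Finsupp.filter_single_of_neg (fun q => p q ∈ M) hi, if_neg fun h' => hi ((h i).mpr h')]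

open Classical in
/-- The part of a weight that is supported on the cells in `M`, rescaled to mass one. -/
def restrictWeight {E Q : Type*} (p : Q → E) (M : Set E) (W : Q →₀ ℝ) : Q →₀ ℝ :=
  (totalMass (W.filter (fun q => p q ∈ M)))⁻¹ • W.filter (fun q => p q ∈ M)

theorem restrictWeight_chainWeight {E Q : Type*} {p : Q → E} {M : Set E} {m k : ℕ} (hm : m + 1 ≤ k + 1)
    {σ : Fin (k + 1) → Q} (h : ∀ i, p (σ i) ∈ M ↔ (i : ℕ) ≤ m) (t : Fin (k + 1) → ℝ) :
    restrictWeight p M (chainWeight σ t) = chainWeight (fun j => σ (Fin.castLE hm j))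
      (fun j => (∑ j, t (Fin.castLE hm j))⁻¹ * t (Fin.castLE hm j)) := by
  classical
  rw [restrictWeight, filter_chainWeight hm h, totalMass_chainWeight, chainWeight_eq_sum,
    chainWeight_eq_sum, Finset.smul_sum]
  simp_rw [smul_smul]

/-! ### The retraction onto the subcomplex of all chains in an upper set of cells -/

section Retraction

variable {E : Type*} [NormedAddCommGroup E] [NormedSpace ℝ E] {r : E → E → Prop}
  {Q : Type*} [PartialOrder Q] {p : Q → E}

theorem FaceSystem.exists_coord (hr : FaceOrder r) (hp : FaceSystem r p) (x : E) :
    ∃ W : Q →₀ ℝ, IsChainWeight W ∧ Finsupp.linearCombination ℝ p W = x := by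
  obtain ⟨k, σ, hσ, t, -, h⟩ := hp.exists_chain hr x
  exact ⟨chainWeight σ t, isChainWeight_chainWeight hσ t,
    (linearCombination_chainWeight p σ t).trans h⟩

/-- The barycentric coordinates of a point. -/
def FaceSystem.coord (hr : FaceOrder r) (hp : FaceSystem r p) (x : E) : Q →₀ ℝ :=
  (hp.exists_coord hr x).choose

/-- By uniqueness of barycentric coordinates the arbitrary choice made in `coord` is harmless: any
chain through the point computes it. -/
theorem FaceSystem.coord_eq (hr : FaceOrder r) (hp : FaceSystem r p) {k : ℕ}
    {σ : Fin (k + 1) → Q} (hσ : StrictMono σ) (t : stdSimplex ℝ (Fin (k + 1))) :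
    hp.coord hr (∑ i, t i • p (σ i)) = chainWeight σ t := by
  have h := (hp.exists_coord hr (∑ i, t i • p (σ i))).choose_spec
  exact hp.chainWeight_unique hr h.1 (isChainWeight_chainWeight hσ t)
    (h.2.trans (linearCombination_chainWeight p σ t).symm)

variable {M : Set E}

/-- Chains run from larger to smaller cells, and `M` contains with a cell all cells having it as a
face; so the vertices in `M` come first. -/
theorem FaceSystem.exists_initial (hp : FaceSystem r p) (hM : ∀ x y, r x y → x ∈ M → y ∈ M)
    {k : ℕ} {σ : Fin (k + 1) → Q} (hσ : StrictMono σ) (h : ∃ i, p (σ i) ∈ M) :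
    ∃ m, m + 1 ≤ k + 1 ∧ ∀ i, p (σ i) ∈ M ↔ (i : ℕ) ≤ m := by
  classical
  obtain ⟨i, hi, hmax⟩ := (Finset.univ.filter fun i => p (σ i) ∈ M).exists_max_image
    (fun i => (i : ℕ)) (by obtain ⟨i, hi⟩ := h; exact ⟨i, by simpa using hi⟩)
  refine ⟨i, by omega, fun j => ⟨fun hj => hmax j (by simpa using hj), fun hj => ?_⟩⟩
  exact hM _ _ ((hp.le_iff _ _).mp (hσ.monotone (show j ≤ i from hj))) (by simpa using hi)

/-- The largest cell of positive weight contains the point in its relative interior, so its chosen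
point is in `M` as well. -/
theorem FaceSystem.exists_pos_mem (hr : FaceOrder r) (hp : FaceSystem r p)
    (hM : ∀ x y, r x y → x ∈ M → y ∈ M)
    {k : ℕ} {σ : Fin (k + 1) → Q} (hσ : StrictMono σ) {t : stdSimplex ℝ (Fin (k + 1))}
    (h : ∑ i, t i • p (σ i) ∈ M) : ∃ i, 0 < t i ∧ p (σ i) ∈ M := by
  have hW := isChainWeight_chainWeight hσ t
  obtain ⟨q, hq, hmin⟩ := hW.exists_top
  obtain ⟨i, rfl⟩ := support_chainWeight_subset σ t (Finsupp.mem_support_iff.mpr hq.ne')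
  refine ⟨i, by rwa [chainWeight_apply hσ.injective] at hq, ?_⟩
  have := (hp.linearCombination_mem_cell hr hW.nonneg hW.total hq hmin).1
  rw [linearCombination_chainWeight] at this
  exact hM _ _ this h

/-- The cut-off `m` depends on the chain only, not on `t`. Thus on the whole part of the simplex in
`M` the truncation is one formula with positive denominator, which is what yields continuity. The
point `t₀` serves only to ensure that some vertex lies in `M`. -/
theorem FaceSystem.exists_truncation (hr : FaceOrder r) (hp : FaceSystem r p)
    (hM : ∀ x y, r x y → x ∈ M → y ∈ M)
    {k : ℕ} {σ : Fin (k + 1) → Q} (hσ : StrictMono σ) {t₀ : stdSimplex ℝ (Fin (k + 1))}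
    (h₀ : ∑ i, t₀ i • p (σ i) ∈ M) : ∃ (m : ℕ) (hm : m + 1 ≤ k + 1),
      (∀ i, p (σ i) ∈ M ↔ (i : ℕ) ≤ m) ∧ ∀ t : stdSimplex ℝ (Fin (k + 1)),
      ∑ i, t i • p (σ i) ∈ M → 0 < ∑ j, t (Fin.castLE hm j) := by
  obtain ⟨i, -, hi⟩ := hp.exists_pos_mem hr hM hσ h₀
  obtain ⟨m, hm, h⟩ := hp.exists_initial hM hσ ⟨i, hi⟩
  refine ⟨m, hm, h, fun t ht => ?_⟩
  obtain ⟨i, hi0, hiM⟩ := hp.exists_pos_mem hr hM hσ ht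
  exact Finset.sum_pos' (fun j _ => t.2.1 _) ⟨⟨i, by have := (h i).mp hiM; omega⟩, by simp, hi0⟩

/-- The retraction of `M` that omits the barycentric coordinates of all cells outside of `M`. -/
def FaceSystem.retract (hr : FaceOrder r) (hp : FaceSystem r p) (M : Set E) (x : E) : E :=
  Finsupp.linearCombination ℝ p (restrictWeight p M (hp.coord hr x))

/-- Cells have bounded diameter, so a simplex that comes near `x` has all its vertices in a fixed
ball. That ball contains finitely many chosen points, and their number bounds the length of a strict
chain. -/
theorem FaceSystem.locallyFinite_simplices (hr : FaceOrder r) (hp : FaceSystem r p) :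
    LocallyFinite fun c : Σ k : ℕ, {σ : Fin (k + 1) → Q // StrictMono σ} =>
      Set.range fun t : stdSimplex ℝ (Fin (c.1 + 1)) => ∑ i, t i • p (c.2.1 i) := by
  classical
  obtain ⟨D, hD⟩ := hr.bounded
  intro x
  refine ⟨Metric.ball x 1, Metric.ball_mem_nhds x one_pos, ?_⟩
  -- A vertex is within `D` of vertex `0`, which is within `D` of the point of the simplex that lies
  -- in the unit ball around `x`.
  have hfin := hp.finite x (D + D + 1)
  set S := {q | dist (p q) x ≤ D + D + 1} with hS
  have hfin2 : (⋃ k ∈ Finset.range S.ncard,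
      (Sigma.mk k) '' {σ : {σ : Fin (k + 1) → Q // StrictMono σ} | ∀ i, σ.1 i ∈ S}).Finite := by
    refine Set.Finite.biUnion (Finset.finite_toSet _) fun k _ => Set.Finite.image _ ?_
    have h : {σ : Fin (k + 1) → Q | ∀ i, σ i ∈ S}.Finite := by
      have := Set.Finite.pi (t := fun _ : Fin (k + 1) => S) (fun _ => hfin)
      simpa [Set.pi] using this
    exact h.preimage Subtype.val_injective.injOn
  refine hfin2.subset ?_
  rintro ⟨k, σ, hσ⟩ ⟨_, ⟨t, rfl⟩, hb⟩
  have hmem : ∀ i, σ i ∈ S := by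
    intro i
    have h0 : ∀ i, r (p (σ i)) (p (σ 0)) := fun i =>
      (hp.le_iff _ _).mp (hσ.monotone (Fin.zero_le i))
    have h1 : r (∑ i, t i • p (σ i)) (p (σ 0)) :=
      (hr.convex _).sum_mem (fun i _ => t.2.1 i) t.2.2 fun i _ => h0 i
    have h2 := hD _ _ (h0 i)
    have h3 := hD _ _ h1
    have h4 : dist (∑ i, t i • p (σ i)) x < 1 := hb
    rw [hS, Set.mem_ofPred_eq]
    have h5 := dist_triangle (p (σ i)) (p (σ 0)) x
    have h6 := dist_triangle_left (p (σ 0)) x (∑ i, t i • p (σ i))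
    linarith
  simp only [Set.mem_iUnion]
  refine ⟨k, ?_, ⟨σ, hσ⟩, hmem, rfl⟩
  rw [Finset.mem_range]
  have h1 := Set.ncard_range_of_injective hσ.injective
  have h2 := Set.ncard_le_ncard (Set.range_subset_iff.mpr hmem) hfin
  rw [h1, Nat.card_eq_fintype_card, Fintype.card_fin] at h2
  omega

/-- Continuity on an upper set of cells can be checked on the closed simplices. -/
theorem FaceSystem.continuous_of_simplices (hr : FaceOrder r) (hp : FaceSystem r p) {Y : Type*}
    [TopologicalSpace Y] {g : M → Y}
    (hg : ∀ (k : ℕ) (σ : Fin (k + 1) → Q), StrictMono σ →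
      Continuous fun t : {t : stdSimplex ℝ (Fin (k + 1)) // ∑ i, t i • p (σ i) ∈ M} =>
        g ⟨∑ i, t.1 i • p (σ i), t.2⟩) : Continuous g := by
  have hcont : ∀ c : Σ k : ℕ, {σ : Fin (k + 1) → Q // StrictMono σ},
      Continuous fun t : stdSimplex ℝ (Fin (c.1 + 1)) => ∑ i, t i • p (c.2.1 i) := by
    intro c
    refine continuous_finsetSum _ fun i _ => ?_
    exact ((continuous_apply i).comp continuous_subtype_val).smul continuous_const
  refine continuous_of_locallyFinite_isClosedMap
    (ψ := fun c : Σ k : ℕ, {σ : Fin (k + 1) → Q // StrictMono σ} =>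
      M.restrictPreimage fun t : stdSimplex ℝ (Fin (c.1 + 1)) => ∑ i, t i • p (c.2.1 i))
    (fun c => ((hcont c).isClosedMap).restrictPreimage M) ?_ ?_ (fun c => hg c.1 c.2.1 c.2.2)
  · refine ((hp.locallyFinite_simplices hr).preimage_continuous
      (continuous_subtype_val (p := fun x => x ∈ M))).subset ?_
    rintro c _ ⟨t, rfl⟩
    exact ⟨t.1, rfl⟩
  · intro x
    obtain ⟨k, σ, hσ, t, -, h⟩ := hp.exists_chain hr x.1
    exact ⟨⟨k, σ, hσ⟩, ⟨t, by rw [Set.mem_preimage, h]; exact x.2⟩, Subtype.ext h⟩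

variable {T : Type*} [TopologicalSpace T]
  {cls : ∀ (k : ℕ) (σ : Fin (k + 1) → {q : Q // p q ∈ M}), StrictMono σ →
    stdSimplex ℝ (Fin (k + 1)) → T}

/-- The truncation of a point of a simplex to an initial face. -/
def truncate {m k : ℕ} (hm : m + 1 ≤ k + 1) (t : stdSimplex ℝ (Fin (k + 1)))
    (ht : 0 < ∑ j, t (Fin.castLE hm j)) : stdSimplex ℝ (Fin (m + 1)) :=
  ⟨fun j => (∑ j, t (Fin.castLE hm j))⁻¹ * t (Fin.castLE hm j),
    fun j => mul_nonneg (inv_nonneg.mpr ht.le) (t.2.1 _), by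
      rw [← Finset.mul_sum, inv_mul_cancel₀ ht.ne']⟩

theorem FaceSystem.exists_restrictWeight (hr : FaceOrder r) (hp : FaceSystem r p)
    (hM : ∀ x y, r x y → x ∈ M → y ∈ M) (x : M) :
    ∃ (k : ℕ) (σ : Fin (k + 1) → {q : Q // p q ∈ M}) (_ : StrictMono σ)
      (t : stdSimplex ℝ (Fin (k + 1))), (∀ i, r (p (σ i)) x) ∧
      chainWeight (fun i => (σ i : Q)) t = restrictWeight p M (hp.coord hr x) := by
  obtain ⟨x, hx⟩ := x
  obtain ⟨k, σ, hσ, t, hle, rfl⟩ := hp.exists_chain hr x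
  obtain ⟨m, hm, h1, h2⟩ := hp.exists_truncation hr hM hσ hx
  refine ⟨m, fun j => ⟨σ (Fin.castLE hm j), (h1 _).mpr (by simp; omega)⟩,
    fun i j hij => hσ hij, truncate hm t (h2 t hx), fun i => hle _, ?_⟩
  simp only
  rw [hp.coord_eq hr hσ, restrictWeight_chainWeight hm h1]
  rfl

/-- The map on `M` that is induced by a chain map on the cells in `M`. -/
def FaceSystem.desc (hr : FaceOrder r) (hp : FaceSystem r p)
    (hM : ∀ x y, r x y → x ∈ M → y ∈ M)
    (cls : ∀ (k : ℕ) (σ : Fin (k + 1) → {q : Q // p q ∈ M}), StrictMono σ →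
      stdSimplex ℝ (Fin (k + 1)) → T) (x : M) : T :=
  cls _ _ (hp.exists_restrictWeight hr hM x).choose_spec.choose_spec.choose
    (hp.exists_restrictWeight hr hM x).choose_spec.choose_spec.choose_spec.choose

/-- A chain map sees only the weights, so any chain in `M` carrying the truncated weights of `x` may
replace the chosen one. -/
theorem FaceSystem.desc_eq (hr : FaceOrder r) (hp : FaceSystem r p)
    (hM : ∀ x y, r x y → x ∈ M → y ∈ M) (hc : IsChainMap cls) (x : M) {k : ℕ}
    {σ : Fin (k + 1) → {q : Q // p q ∈ M}} (hσ : StrictMono σ) {t : stdSimplex ℝ (Fin (k + 1))}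
    (h : chainWeight (fun i => (σ i : Q)) t = restrictWeight p M (hp.coord hr x)) :
    hp.desc hr hM cls x = cls k σ hσ t := by
  have h' := (hp.exists_restrictWeight hr hM x).choose_spec.choose_spec.choose_spec.choose_spec.2
  -- The chain map lives on cells in `M`, while coordinates are weights on all cells; the two are
  -- compared after pushing forward along the inclusion.
  refine hc.eq_of_chainWeight_eq _ _
    (Finsupp.mapDomain_injective (Subtype.val_injective (p := fun q => p q ∈ M)) ?_)
  have hmap : ∀ (l : ℕ) (τ : Fin (l + 1) → {q : Q // p q ∈ M}) (s : Fin (l + 1) → ℝ),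
      Finsupp.mapDomain Subtype.val (chainWeight τ s) = chainWeight (fun i => (τ i : Q)) s := by
    intro l τ s
    simp [chainWeight, Finsupp.mapDomain_finsetSum, Finsupp.mapDomain_single]
  rw [hmap, hmap]
  exact h'.trans h.symm

theorem FaceSystem.exists_desc_eq (hr : FaceOrder r) (hp : FaceSystem r p)
    (hM : ∀ x y, r x y → x ∈ M → y ∈ M) (hc : IsChainMap cls) (x : M) :
    ∃ (k : ℕ) (σ : Fin (k + 1) → {q : Q // p q ∈ M}) (hσ : StrictMono σ)
      (t : stdSimplex ℝ (Fin (k + 1))), (∀ i, r (p (σ i)) x) ∧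
      hp.desc hr hM cls x = cls k σ hσ t ∧ hp.retract hr M x = ∑ i, t i • p (σ i) := by
  obtain ⟨k, σ, hσ, t, h1, h2⟩ := hp.exists_restrictWeight hr hM x
  refine ⟨k, σ, hσ, t, h1, hp.desc_eq hr hM hc x hσ h2, ?_⟩
  rw [FaceSystem.retract, ← h2, linearCombination_chainWeight]

/-- No vertex lies outside `M`, so nothing is truncated. This is why one of the two final composites
is the identity and not merely homotopic to it. -/
theorem FaceSystem.desc_sum (hr : FaceOrder r) (hp : FaceSystem r p)
    (hM : ∀ x y, r x y → x ∈ M → y ∈ M) (hc : IsChainMap cls) {k : ℕ}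
    {σ : Fin (k + 1) → {q : Q // p q ∈ M}} (hσ : StrictMono σ) (t : stdSimplex ℝ (Fin (k + 1)))
    (h : ∑ i, t i • p (σ i) ∈ M) : hp.desc hr hM cls ⟨∑ i, t i • p (σ i), h⟩ = cls k σ hσ t := by
  refine hp.desc_eq hr hM hc _ hσ ?_
  have hσ' : StrictMono fun i => (σ i : Q) := fun i j hij => hσ hij
  rw [hp.coord_eq hr hσ', restrictWeight_chainWeight (m := k) le_rfl
    (fun i => ⟨fun _ => by omega, fun _ => (σ i).2⟩)]
  have h1 : ∑ j, t (Fin.castLE le_rfl j) = 1 := t.2.2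
  rw [h1]
  simp

theorem FaceSystem.continuous_desc (hr : FaceOrder r) (hp : FaceSystem r p)
    (hM : ∀ x y, r x y → x ∈ M → y ∈ M) (hc : IsChainMap cls) :
    Continuous (hp.desc hr hM cls) := by
  refine hp.continuous_of_simplices hr fun k σ hσ => ?_
  rw [continuous_iff_continuousAt]
  intro t₀
  obtain ⟨m, hm, h1, h2⟩ := hp.exists_truncation hr hM hσ t₀.2
  have h : (fun t : {t : stdSimplex ℝ (Fin (k + 1)) // ∑ i, t i • p (σ i) ∈ M} =>
      hp.desc hr hM cls ⟨∑ i, t.1 i • p (σ i), t.2⟩) = fun t =>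
      cls m (fun j => ⟨σ (Fin.castLE hm j), (h1 _).mpr (by simp; omega)⟩) (fun i j hij => hσ hij)
        (truncate hm t.1 (h2 t.1 t.2)) := by
    funext t
    refine hp.desc_eq hr hM hc _ _ ?_
    simp only
    rw [hp.coord_eq hr hσ, restrictWeight_chainWeight hm h1]
    rfl
  rw [h]
  refine Continuous.continuousAt ((hc.continuous _ _ _).comp (Continuous.subtype_mk ?_ _))
  have hev : ∀ i, Continuous fun t : {t : stdSimplex ℝ (Fin (k + 1)) // ∑ i, t i • p (σ i) ∈ M} =>
      t.1 i := fun i =>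
    (continuous_apply i).comp (continuous_subtype_val.comp continuous_subtype_val)
  refine continuous_pi fun j => Continuous.mul (Continuous.inv₀ ?_ fun t => (h2 t.1 t.2).ne') (hev _)
  exact continuous_finsetSum _ fun j _ => hev _

theorem FaceSystem.continuous_retract (hr : FaceOrder r) (hp : FaceSystem r p)
    (hM : ∀ x y, r x y → x ∈ M → y ∈ M) :
    Continuous fun x : M => hp.retract hr M x := by
  refine hp.continuous_of_simplices hr fun k σ hσ => ?_
  rw [continuous_iff_continuousAt]
  intro t₀
  obtain ⟨m, hm, h1, h2⟩ := hp.exists_truncation hr hM hσ t₀.2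
  have h : (fun t : {t : stdSimplex ℝ (Fin (k + 1)) // ∑ i, t i • p (σ i) ∈ M} =>
      hp.retract hr M (∑ i, t.1 i • p (σ i))) = fun t => ∑ j : Fin (m + 1),
      ((∑ j, t.1 (Fin.castLE hm j))⁻¹ * t.1 (Fin.castLE hm j)) • p (σ (Fin.castLE hm j)) := by
    funext t
    rw [FaceSystem.retract, hp.coord_eq hr hσ, restrictWeight_chainWeight hm h1,
      linearCombination_chainWeight]
  rw [h]
  refine Continuous.continuousAt (continuous_finsetSum _ fun j _ => Continuous.smul ?_
    continuous_const)
  have hev : ∀ i, Continuous fun t : {t : stdSimplex ℝ (Fin (k + 1)) // ∑ i, t i • p (σ i) ∈ M} =>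
      t.1 i := fun i =>
    (continuous_apply i).comp (continuous_subtype_val.comp continuous_subtype_val)
  refine Continuous.mul (Continuous.inv₀ ?_ fun t => (h2 t.1 t.2).ne') (hev _)
  exact continuous_finsetSum _ fun j _ => hev _

/-- The vertices that are kept lie in the closed cell of `x`, which is convex. -/
theorem FaceSystem.retract_rel (hr : FaceOrder r) (hp : FaceSystem r p)
    (hM : ∀ x y, r x y → x ∈ M → y ∈ M) (x : M) : r (hp.retract hr M x) x := by
  obtain ⟨k, σ, hσ, t, h1, h2⟩ := hp.exists_restrictWeight hr hM x
  rw [FaceSystem.retract, ← h2, linearCombination_chainWeight]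
  exact (hr.convex _).sum_mem (fun i _ => t.2.1 i) t.2.2 fun i _ => h1 i

/-- A convex combination along a chain lies in the open cell of its largest vertex of positive
weight, and `M` is a union of open cells. -/
theorem FaceSystem.sum_mem (hr : FaceOrder r) (hp : FaceSystem r p)
    (hM : ∀ x y, r x y → x ∈ M → y ∈ M) {k : ℕ} {σ : Fin (k + 1) → {q : Q // p q ∈ M}}
    (hσ : StrictMono σ) (t : stdSimplex ℝ (Fin (k + 1))) : ∑ i, t i • p (σ i) ∈ M := by
  have hσ' : StrictMono fun i => (σ i : Q) := fun i j hij => hσ hij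
  have hW := isChainWeight_chainWeight hσ' t
  obtain ⟨q, hq, hmin⟩ := hW.exists_top
  obtain ⟨i, rfl⟩ := support_chainWeight_subset _ t (Finsupp.mem_support_iff.mpr hq.ne')
  have := (hp.linearCombination_mem_cell hr hW.nonneg hW.total hq hmin).2
  rw [linearCombination_chainWeight] at this
  exact hM _ _ this (σ i).2

theorem FaceSystem.retract_mem (hr : FaceOrder r) (hp : FaceSystem r p)
    (hM : ∀ x y, r x y → x ∈ M → y ∈ M) (x : M) : hp.retract hr M x ∈ M := by
  obtain ⟨k, σ, hσ, t, h1, h2⟩ := hp.exists_restrictWeight hr hM x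
  rw [FaceSystem.retract, ← h2, linearCombination_chainWeight]
  exact hp.sum_mem hr hM hσ t

/-- The retracted point is in the closed cell of `x`, so up to its end point the segment stays in
the open cell of `x`; the end point is in `M` by `retract_mem`. -/
theorem FaceSystem.segment_mem (hr : FaceOrder r) (hp : FaceSystem r p)
    (hM : ∀ x y, r x y → x ∈ M → y ∈ M) (x : M) {s : ℝ} (h0 : 0 ≤ s) (h1 : s ≤ 1) :
    (1 - s) • (x : E) + s • hp.retract hr M x ∈ M := by
  rcases h1.eq_or_lt with rfl | h1
  · simpa using hp.retract_mem hr hM x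
  · have h := hr.interior (hp.retract_rel hr hM x) (1 - s) (by linarith) (by linarith)
    rw [sub_sub_cancel, add_comm] at h
    exact hM _ _ h x.2

/-- Invariance under a translation that permutes the cells. -/
theorem FaceSystem.desc_add (hr : FaceOrder r) (hp : FaceSystem r p)
    (hM : ∀ x y, r x y → x ∈ M → y ∈ M) (hc : IsChainMap cls) {v : E}
    (hMv : ∀ x, x + v ∈ M ↔ x ∈ M) {g : Q → Q} (hg : StrictMono g) (hgp : ∀ q, p (g q) = p q + v)
    (hcls : ∀ k σ hσ t, cls k (fun i => ⟨g (σ i), by rw [hgp, hMv]; exact (σ i).2⟩)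
      (fun _ _ hij => hg (hσ hij)) t = cls k σ hσ t) (x : M) :
    hp.desc hr hM cls ⟨x + v, (hMv x).mpr x.2⟩ = hp.desc hr hM cls x ∧
      hp.retract hr M (x + v) = hp.retract hr M x + v := by
  obtain ⟨x, hx⟩ := x
  obtain ⟨k, σ, hσ, t, hle, rfl⟩ := hp.exists_chain hr x
  obtain ⟨m, hm, h1, h2⟩ := hp.exists_truncation hr hM hσ hx
  have hadd : ∀ (l : ℕ) (τ : Fin (l + 1) → Q) (s : stdSimplex ℝ (Fin (l + 1))),
      ∑ i, s i • p (τ i) + v = ∑ i, s i • p (g (τ i)) := by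
    intro l τ s
    have : ∑ i, s i = 1 := s.2.2
    simp_rw [hgp, smul_add, Finset.sum_add_distrib, ← Finset.sum_smul, this, one_smul]
  have h1' : ∀ i, p (g (σ i)) ∈ M ↔ (i : ℕ) ≤ m := fun i => by rw [hgp, hMv, h1]
  have hgσ : StrictMono (g ∘ σ) := hg.comp hσ
  have e1 : hp.coord hr (∑ i, t i • p (σ i) + v) = chainWeight (g ∘ σ) t := by
    rw [hadd, ← hp.coord_eq hr hgσ]; rfl
  set τ : Fin (m + 1) → {q : Q // p q ∈ M} :=
    fun j => ⟨σ (Fin.castLE hm j), (h1 _).mpr (by simp; omega)⟩ with hτdef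
  have hτ : StrictMono τ := fun i j hij => hσ hij
  have w1 : chainWeight (fun i => (τ i : Q)) (truncate hm t (h2 t hx)) =
      restrictWeight p M (hp.coord hr (∑ i, t i • p (σ i))) := by
    rw [hp.coord_eq hr hσ, restrictWeight_chainWeight hm h1]
    rfl
  have w2 : chainWeight (fun i => g (τ i)) (truncate hm t (h2 t hx)) =
      restrictWeight p M (hp.coord hr (∑ i, t i • p (σ i) + v)) := by
    rw [e1, restrictWeight_chainWeight (σ := g ∘ σ) hm h1']
    rfl
  constructor
  · rw [hp.desc_eq hr hM hc ⟨_, hx⟩ hτ w1, ← hcls m τ hτ]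
    exact hp.desc_eq hr hM hc _ _ w2
  · rw [FaceSystem.retract, FaceSystem.retract, ← w1, ← w2, linearCombination_chainWeight,
      linearCombination_chainWeight, hadd]

end Retraction

/-! ### The face order of the lifted toric arrangement -/

theorem FaceOrder.prod {E F : Type*} [NormedAddCommGroup E] [NormedSpace ℝ E]
    [NormedAddCommGroup F] [NormedSpace ℝ F] {r : E → E → Prop} {s : F → F → Prop}
    (hr : FaceOrder r) (hs : FaceOrder s) :
    FaceOrder fun x y : E × F => r x.1 y.1 ∧ s x.2 y.2 where
  refl x := ⟨hr.refl _, hs.refl _⟩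
  trans h h' := ⟨hr.trans h.1 h'.1, hs.trans h.2 h'.2⟩
  convex z := ((hr.convex z.1).is_linear_preimage (f := Prod.fst) ⟨fun _ _ => rfl, fun _ _ => rfl⟩).inter
    ((hs.convex z.2).is_linear_preimage (f := Prod.snd) ⟨fun _ _ => rfl, fun _ _ => rfl⟩)
  interior h t h0 h1 := ⟨hr.interior h.1 t h0 h1, hs.interior h.2 t h0 h1⟩
  isClosed z := ((hr.isClosed z.1).preimage continuous_fst).inter
    ((hs.isClosed z.2).preimage continuous_snd)
  eventually x := (hr.eventually x.1).prod_nhds (hs.eventually x.2)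
  extend u h h' h'' := ⟨hr.extend u h.1 h'.1 h''.1, hs.extend u h.2 h'.2 h''.2⟩
  bounded := by
    obtain ⟨D, hD⟩ := hr.bounded
    obtain ⟨D', hD'⟩ := hs.bounded
    exact ⟨max D D', fun x y h => max_le_max (hD _ _ h.1) (hD' _ _ h.2)⟩

theorem FaceSystem.prod {E F : Type*} [NormedAddCommGroup E] [NormedSpace ℝ E]
    [NormedAddCommGroup F] [NormedSpace ℝ F] {r : E → E → Prop} {s : F → F → Prop}
    {P Q : Type*} [PartialOrder P] [PartialOrder Q] {p : P → E} {q : Q → F}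
    (hp : FaceSystem r p) (hq : FaceSystem s q) :
    FaceSystem (fun x y : E × F => r x.1 y.1 ∧ s x.2 y.2) (Prod.map p q) where
  le_iff a b := and_congr (hp.le_iff _ _) (hq.le_iff _ _)
  surj x := by
    obtain ⟨a, ha⟩ := hp.surj x.1
    obtain ⟨b, hb⟩ := hq.surj x.2
    exact ⟨(a, b), ⟨ha.1, hb.1⟩, ⟨ha.2, hb.2⟩⟩
  finite x D := ((hp.finite x.1 D).prod (hq.finite x.2 D)).subset fun a ha =>
    ⟨le_trans (le_max_left _ _) (show dist (Prod.map p q a) x ≤ D from ha),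
      le_trans (le_max_right _ _) (show dist (Prod.map p q a) x ≤ D from ha)⟩

/-! ### The subdivision of the line by the integers. -/

/-- The real number `s` lies in the closure of the cell of `t` in the subdivision of the line by
the integers. -/
def lineRel (s t : ℝ) : Prop := (⌊t⌋ : ℝ) ≤ s ∧ s ≤ ⌈t⌉

namespace lineRel

theorem refl (s : ℝ) : lineRel s s := ⟨Int.floor_le s, Int.le_ceil s⟩

theorem trans {s t v : ℝ} (h : lineRel s t) (h' : lineRel t v) : lineRel s v := by
  refine ⟨le_trans ?_ h.1, h.2.trans ?_⟩
  · exact_mod_cast Int.le_floor.mpr h'.1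
  · exact_mod_cast Int.ceil_le.mpr h'.2

theorem eq_of_int {s : ℝ} {m : ℤ} (h : lineRel s m) : s = m := by
  have h1 := h.1
  have h2 := h.2
  rw [Int.floor_intCast] at h1
  rw [Int.ceil_intCast] at h2
  exact le_antisymm h2 h1

/-- The hypotheses force `t` to be non-integral, with `w` in the same open unit interval. -/
theorem of_lt {t w : ℝ} (h1 : (⌊t⌋ : ℝ) < w) (h2 : w < ⌈t⌉) : lineRel t w := by
  have h3 : ⌈t⌉ ≤ ⌊t⌋ + 1 := Int.ceil_le_floor_add_one t
  constructor
  · have : ⌊w⌋ < ⌈t⌉ := by exact_mod_cast (Int.floor_le w).trans_lt h2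
    have : ⌊w⌋ ≤ ⌊t⌋ := by omega
    exact le_trans (by exact_mod_cast this) (Int.floor_le t)
  · have : ⌊t⌋ < ⌈w⌉ := by exact_mod_cast h1.trans_le (Int.le_ceil w)
    have : ⌈t⌉ ≤ ⌈w⌉ := by omega
    exact (Int.le_ceil t).trans (by exact_mod_cast this)

theorem int_or_lt (t : ℝ) : (∃ m : ℤ, t = m) ∨ ((⌊t⌋ : ℝ) < t ∧ t < ⌈t⌉) := by
  by_cases h : (⌊t⌋ : ℝ) = t
  · exact Or.inl ⟨_, h.symm⟩
  · right
    have h1 := lt_of_le_of_ne (Int.floor_le t) h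
    refine ⟨h1, lt_of_le_of_ne (Int.le_ceil t) fun h2 => ?_⟩
    apply h
    rw [h2, Int.floor_intCast]

theorem interior {s t : ℝ} (h : lineRel s t) (a : ℝ) (h0 : 0 < a) (h1 : a ≤ 1) :
    lineRel t ((1 - a) * s + a * t) := by
  rcases int_or_lt t with ⟨m, rfl⟩ | ⟨h2, h3⟩
  · rw [h.eq_of_int, show (1 - a) * (m : ℝ) + a * m = m by ring]
    exact refl _
  · have h4 := h.1
    have h5 := h.2
    apply of_lt <;> nlinarith

theorem eventually (s : ℝ) : ∀ᶠ t in 𝓝 s, lineRel s t := by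
  have h1 : s < ⌊s⌋ + 1 := Int.lt_floor_add_one s
  have h2 : (⌈s⌉ : ℝ) - 1 < s := by linarith [Int.ceil_lt_add_one s]
  filter_upwards [Ioo_mem_nhds h2 h1] with t ht
  constructor
  · have : ⌊t⌋ < ⌊s⌋ + 1 := by exact_mod_cast (Int.floor_le t).trans_lt ht.2
    exact le_trans (by exact_mod_cast Int.lt_add_one_iff.mp this) (Int.floor_le s)
  · have : ⌈s⌉ - 1 < ⌈t⌉ := by exact_mod_cast ht.1.trans_le (Int.le_ceil t)
    exact (Int.le_ceil s).trans (by exact_mod_cast (by omega : ⌈s⌉ ≤ ⌈t⌉))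

/-- Collinearity matters only for integral `t`, where it forces the third point to equal `t`; for
non-integral `t` the relation `h` alone suffices. -/
theorem extend {p t : ℝ} (a : ℝ) (h1 : lineRel p t)
    (h : lineRel t (p + a * (t - p))) : lineRel (p + a * (t - p)) t := by
  rcases int_or_lt t with ⟨m, rfl⟩ | ⟨h2, h3⟩
  · rw [h1.eq_of_int, sub_self, mul_zero, add_zero]
    exact refl _
  · rcases int_or_lt (p + a * (t - p)) with ⟨m, hm⟩ | ⟨h4, h5⟩
    · rw [hm] at h
      rw [hm, h.eq_of_int]
      exact refl _
    · have h6 : (⌊p + a * (t - p)⌋ : ℝ) < t := lt_of_le_of_ne h.1 fun h7 => by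
        rw [← h7, Int.floor_intCast] at h2; exact lt_irrefl _ h2
      have h8 : t < ⌈p + a * (t - p)⌉ := lt_of_le_of_ne h.2 fun h7 => by
        rw [h7, Int.ceil_intCast] at h3; exact lt_irrefl _ h3
      exact of_lt h6 h8

theorem abs_sub_le {s t : ℝ} (h : lineRel s t) : |s - t| ≤ 1 := by
  have h3 : (⌈t⌉ : ℝ) ≤ ⌊t⌋ + 1 := by exact_mod_cast Int.ceil_le_floor_add_one t
  have := Int.floor_le t
  have := Int.le_ceil t
  rw [abs_le]
  constructor <;> linarith [h.1, h.2]

theorem add_int {s t : ℝ} (m : ℤ) : lineRel (s + m) (t + m) ↔ lineRel s t := by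
  simp [lineRel]

theorem sign_eq {s t : ℝ} (h : lineRel s t) (h' : lineRel t s) (m : ℤ) :
    SignType.sign (s - m) = SignType.sign (t - m) := by
  have key : ∀ {s t : ℝ}, lineRel s t → ((m : ℝ) < s → (m : ℝ) < t) ∧ (s < m → t < m) := by
    intro s t h
    refine ⟨fun hm => ?_, fun hm => ?_⟩
    · exact Int.lt_ceil.mp (by exact_mod_cast hm.trans_le h.2)
    · exact Int.floor_lt.mp (by exact_mod_cast h.1.trans_lt hm)
  rcases lt_trichotomy (m : ℝ) s with hm | hm | hm
  · rw [sign_pos (sub_pos.mpr hm), sign_pos (sub_pos.mpr ((key h).1 hm))]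
  · have : t = m := by
      rcases lt_trichotomy (m : ℝ) t with ht | ht | ht
      · exact absurd ((key h').1 ht) (by rw [hm]; exact lt_irrefl _)
      · exact ht.symm
      · exact absurd ((key h').2 ht) (by rw [hm]; exact lt_irrefl _)
    rw [← hm, this]
  · rw [sign_neg (sub_neg.mpr hm), sign_neg (sub_neg.mpr ((key h).2 hm))]

theorem of_sign_eq {s t : ℝ} (h : ∀ m : ℤ, SignType.sign (s - m) = SignType.sign (t - m)) :
    lineRel s t := by
  constructor
  · rw [← sub_nonneg, ← sign_nonneg_iff, h, sign_nonneg_iff, sub_nonneg]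
    exact Int.floor_le t
  · rw [← sub_nonpos, ← sign_nonpos_iff, h, sign_nonpos_iff, sub_nonpos]
    exact Int.le_ceil t

end lineRel

/-! ### Height functions and the face relation on `ℝᵈ`. -/

variable {d n : ℕ}

/-- A real lift of the constant of the `j`-th hypersurface. -/
def constLift (b : Fin n → UnitAddCircle) (j : Fin n) : ℝ := (QuotientAddGroup.mk_surjective (b j)).choose

theorem coe_constLift (b : Fin n → UnitAddCircle) (j : Fin n) :
    (constLift b j : UnitAddCircle) = b j := (QuotientAddGroup.mk_surjective (b j)).choose_spec

/-- The affine function whose integral level sets are the hyperplanes of the lifted arrangement. -/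
def height (A : Matrix (Fin d) (Fin n) ℤ) (b : Fin n → UnitAddCircle) (j : Fin n)
    (x : Fin d → ℝ) : ℝ := ∑ k, (A k j : ℝ) * x k - constLift b j

/-- The point `x` lies in the closed face that contains `y` in its relative interior. -/
def faceRel (A : Matrix (Fin d) (Fin n) ℤ) (b : Fin n → UnitAddCircle) (x y : Fin d → ℝ) : Prop :=
  ∀ j, lineRel (height A b j x) (height A b j y)

/-- The real vector of an integer vector. -/
def intVec (v : Fin d → ℤ) : Fin d → ℝ := fun k => v k

theorem intVec_zero : intVec (0 : Fin d → ℤ) = 0 := by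
  funext k; simp [intVec]

theorem intVec_add (v w : Fin d → ℤ) : intVec (v + w) = intVec v + intVec w := by
  funext k; simp [intVec]

theorem intVec_injective : Function.Injective (intVec (d := d)) := fun v w h => by
  funext k
  exact Int.cast_injective (α := ℝ) (congrFun h k)

variable (A : Matrix (Fin d) (Fin n) ℤ) (b : Fin n → UnitAddCircle)

theorem height_add_intVec (j : Fin n) (x : Fin d → ℝ) (v : Fin d → ℤ) :
    height A b j (x + intVec v) = height A b j x + (∑ k, A k j * v k : ℤ) := by
  simp only [height, Pi.add_apply, intVec, mul_add, Finset.sum_add_distrib]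
  push_cast
  ring

theorem height_affine (j : Fin n) (x y : Fin d → ℝ) (s t : ℝ) (h : s + t = 1) :
    height A b j (s • x + t • y) = s * height A b j x + t * height A b j y := by
  simp only [height, Pi.add_apply, Pi.smul_apply, smul_eq_mul, mul_add, Finset.sum_add_distrib,
    mul_sub, Finset.mul_sum]
  rw [Finset.sum_congr rfl fun k _ => mul_left_comm (A k j : ℝ) s (x k),
    Finset.sum_congr rfl fun k _ => mul_left_comm (A k j : ℝ) t (y k)]
  linear_combination (constLift b j) * h

@[fun_prop]
theorem continuous_height (j : Fin n) : Continuous (height A b j) := by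
  unfold height
  fun_prop

variable {A b}

theorem faceRel_add_intVec {x y : Fin d → ℝ} (v : Fin d → ℤ) :
    faceRel A b (x + intVec v) (y + intVec v) ↔ faceRel A b x y := by
  simp only [faceRel, height_add_intVec, lineRel.add_int]

/-- The real lifts of `b j` are the numbers `constLift b j + m` with `m` an integer, so signs with
respect to all lifted hyperplanes record the cell of each height in the subdivided line. -/
theorem sameFace_iff {x y : Fin d → ℝ} : SameFace A b x y ↔ faceRel A b x y ∧ faceRel A b y x := by
  constructor
  · intro h
    have h' : ∀ (j : Fin n) (m : ℤ),
        SignType.sign (height A b j x - m) = SignType.sign (height A b j y - m) := by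
      intro j m
      have := h j (constLift b j + m) (by
        rw [AddCircle.coe_add, coe_constLift]
        simp)
      simpa only [height, sub_sub] using this
    exact ⟨fun j => lineRel.of_sign_eq (h' j), fun j => lineRel.of_sign_eq fun m => (h' j m).symm⟩
  · rintro ⟨h1, h2⟩ j β hβ
    rw [← coe_constLift b j] at hβ
    obtain ⟨m, hm⟩ := AddSubgroup.mem_zmultiples_iff.mp (QuotientAddGroup.eq.mp hβ.symm)
    have hm' : β = constLift b j + m := by
      simp at hm
      linarith
    have := lineRel.sign_eq (h1 j) (h2 j) m
    simpa only [height, sub_sub, hm'] using this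

/-- The rank condition: the arrangement is essential. -/
theorem exists_dist_le (hA : (A.map (Int.cast : ℤ → ℝ)).rank = d) :
    ∃ D : ℝ, ∀ x y, faceRel A b x y → dist x y ≤ D := by
  set B : Matrix (Fin n) (Fin d) ℝ := (A.map (Int.cast : ℤ → ℝ)).transpose with hB
  have hker : LinearMap.ker B.mulVecLin = ⊥ := by
    have h1 : Module.finrank ℝ (LinearMap.range B.mulVecLin) = d := by
      rw [← Matrix.rank, hB, Matrix.rank_transpose, hA]
    have h2 := LinearMap.finrank_range_add_finrank_ker B.mulVecLin
    rw [h1, Module.finrank_fin_fun] at h2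
    exact Submodule.finrank_eq_zero.mp (by omega)
  -- Full rank makes the linear part of the heights injective, so distances are controlled by height
  -- differences, and these are at most `1` within a closed cell.
  obtain ⟨K, -, hK⟩ := LinearMap.exists_antilipschitzWith B.mulVecLin hker
  refine ⟨K * 1, fun x y h => (hK.le_mul_dist x y).trans ?_⟩
  refine mul_le_mul_of_nonneg_left ((dist_pi_le_iff zero_le_one).mpr fun j => ?_) K.2
  have h1 := (h j).abs_sub_le
  rw [Real.dist_eq]
  refine le_trans (le_of_eq ?_) h1
  congr 1
  simp [height, hB, Matrix.vecMul, dotProduct, mul_comm]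

/-- Heights are affine and continuous, so every axiom but boundedness reduces to the subdivided
line; boundedness is the rank condition. -/
theorem faceOrder_faceRel (hA : (A.map (Int.cast : ℤ → ℝ)).rank = d) :
    FaceOrder (faceRel A b) where
  refl x j := lineRel.refl _
  trans h h' j := (h j).trans (h' j)
  convex z := by
    intro x hx y hy s t hs ht hst j
    rw [height_affine A b j x y s t hst]
    obtain ⟨h1, h2⟩ := hx j
    obtain ⟨h3, h4⟩ := hy j
    have e1 : ∀ c : ℝ, c = s * c + t * c := fun c => by rw [← add_mul, hst, one_mul]
    constructor
    · rw [e1 (⌊height A b j z⌋ : ℝ)]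
      gcongr
    · rw [e1 (⌈height A b j z⌉ : ℝ)]
      gcongr
  interior h t h0 h1 j := by
    rw [height_affine A b j _ _ (1 - t) t (by ring)]
    exact (h j).interior t h0 h1
  isClosed z := by
    simp only [faceRel, lineRel, Set.ofPred_forall, Set.ofPred_and]
    exact isClosed_iInter fun j => (isClosed_le continuous_const (by fun_prop)).inter
      (isClosed_le (by fun_prop) continuous_const)
  eventually x := by
    simp only [faceRel]
    rw [Filter.eventually_all]
    exact fun j => (continuous_height A b j).continuousAt.eventually (lineRel.eventually _)
  extend {p y} u _ h2 h3 j := by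
    have e : height A b j (p + u • (y - p)) =
        height A b j p + u * (height A b j y - height A b j p) := by
      rw [show p + u • (y - p) = (1 - u) • p + u • y by module,
        height_affine A b j _ _ (1 - u) u (by ring)]
      ring
    have h4 := h3 j
    rw [e] at h4 ⊢
    exact lineRel.extend u (h2 j) h4
  bounded := exists_dist_le hA

theorem finite_floor_ceil (x : Fin d → ℝ) (D : ℝ) :
    ((fun y j => (⌊height A b j y⌋, ⌈height A b j y⌉)) '' Metric.closedBall x D).Finite := by
  have h : ∀ j, ∃ C : ℝ, ∀ y ∈ Metric.closedBall x D, |height A b j y| ≤ C := fun j => by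
    obtain ⟨C, hC⟩ := (isCompact_closedBall x D).exists_bound_of_continuousOn
      (continuous_height A b j).continuousOn
    exact ⟨C, hC⟩
  choose C hC using h
  refine (Set.Finite.pi (t := fun j => Set.Icc (⌊-C j⌋) (⌊C j⌋) ×ˢ Set.Icc (⌈-C j⌉) (⌈C j⌉))
    (fun j => (Set.finite_Icc _ _).prod (Set.finite_Icc _ _))).subset ?_
  rintro _ ⟨y, hy, rfl⟩ j -
  obtain ⟨h1, h2⟩ := abs_le.mp (hC j y hy)
  exact ⟨⟨Int.floor_mono h1, Int.floor_mono h2⟩, ⟨Int.ceil_mono h1, Int.ceil_mono h2⟩⟩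

/-! ### The faces of the lifted arrangement as translates of the chosen lifts of the cells -/

theorem torusProj_add_intVec (x : Fin d → ℝ) (v : Fin d → ℤ) :
    torusProj d (x + intVec v) = torusProj d x := by
  funext k
  simp [torusProj, intVec]

theorem exists_eq_add_intVec {x y : Fin d → ℝ} (h : torusProj d x = torusProj d y) :
    ∃ v : Fin d → ℤ, y = x + intVec v := by
  have h' : ∀ k, ∃ m : ℤ, y k = x k + m := by
    intro k
    have hk : (x k : UnitAddCircle) = y k := congrFun h k
    obtain ⟨m, hm⟩ := AddSubgroup.mem_zmultiples_iff.mp (QuotientAddGroup.eq.mp hk)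
    refine ⟨m, ?_⟩
    simp at hm
    linarith
  choose v hv using h'
  exact ⟨v, funext hv⟩

theorem cellLift_mem (e : toricCells A b) : cellLift A b e ∈ liftedFaces A b :=
  (Classical.choose_spec e.2).1

theorem image_cellLift (e : toricCells A b) : torusProj d '' cellLift A b e = e.1 :=
  (Classical.choose_spec e.2).2

/-- A point in the relative interior of the polytope of a cell. -/
def cellPoint (e : toricCells A b) : Fin d → ℝ := (cellLift_mem e).choose

theorem cellLift_eq (e : toricCells A b) :
    cellLift A b e = {y | faceRel A b (cellPoint e) y ∧ faceRel A b y (cellPoint e)} := by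
  refine ((cellLift_mem e).choose_spec).trans ?_
  ext y
  exact sameFace_iff

theorem cell_eq (e : toricCells A b) : e.1 = torusProj d ''
    {y | faceRel A b (cellPoint e) y ∧ faceRel A b y (cellPoint e)} := by
  rw [← cellLift_eq, image_cellLift]

/-- The faces of the lifted arrangement: the pair `(e, v)` stands for the translate by `v` of the
chosen lift of the cell `e`. -/
def LiftedFace (A : Matrix (Fin d) (Fin n) ℤ) (b : Fin n → UnitAddCircle) : Type :=
  toricCells A b × (Fin d → ℤ)

/-- The chosen point in the relative interior of a face of the lifted arrangement. -/
def facePoint (q : LiftedFace A b) : Fin d → ℝ := cellPoint q.1 + intVec q.2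

theorem image_face_add_intVec (x : Fin d → ℝ) (v : Fin d → ℤ) :
    torusProj d '' {y | faceRel A b (x + intVec v) y ∧ faceRel A b y (x + intVec v)} =
      torusProj d '' {y | faceRel A b x y ∧ faceRel A b y x} := by
  ext z
  constructor
  · rintro ⟨y, hy, rfl⟩
    obtain ⟨w, rfl⟩ : ∃ w, y = w + intVec v := ⟨y - intVec v, by simp⟩
    refine ⟨w, ?_, (torusProj_add_intVec w v).symm⟩
    simpa only [Set.mem_ofPred_eq, faceRel_add_intVec] using hy
  · rintro ⟨y, hy, rfl⟩
    exact ⟨y + intVec v, by simpa only [Set.mem_ofPred_eq, faceRel_add_intVec] using hy,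
      torusProj_add_intVec y v⟩

/-- If the closed cell of `x` contained `x + v` with `v ≠ 0`, iterating would place all `x + m v` in
it, against boundedness. This freeness of the lattice action underlies both acyclicity and the
unique labelling of lifted faces. -/
theorem eq_zero_of_faceRel_add (hA : (A.map (Int.cast : ℤ → ℝ)).rank = d) {x : Fin d → ℝ}
    {v : Fin d → ℤ} (h : faceRel A b (x + intVec v) x) : v = 0 := by
  obtain ⟨D, hD⟩ := exists_dist_le (b := b) hA
  have hm : ∀ m : ℕ, faceRel A b (x + intVec (m • v)) x := by
    intro m
    induction m with
    | zero => simpa [intVec_zero] using (faceOrder_faceRel (b := b) hA).refl x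
    | succ m ih =>
      refine (faceOrder_faceRel hA).trans ?_ h
      rw [succ_nsmul, intVec_add, ← add_assoc]
      exact (faceRel_add_intVec v).mpr ih
  by_contra hv
  have hpos : 0 < ‖intVec v‖ := norm_pos_iff.mpr fun h0 => hv (intVec_injective (h0.trans intVec_zero.symm))
  obtain ⟨m, hm'⟩ := exists_nat_gt (D / ‖intVec v‖)
  have h1 := hD _ _ (hm m)
  rw [dist_eq_norm, add_sub_cancel_left, show intVec (m • v) = (m : ℝ) • intVec v by
    funext k; simp [intVec], norm_smul, Real.norm_natCast] at h1
  rw [div_lt_iff₀ hpos] at hm'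
  linarith

/-- Points of one open cell upstairs give the same cell of the torus; the two shifts then agree by
freeness. -/
theorem facePoint_injective (hA : (A.map (Int.cast : ℤ → ℝ)).rank = d) {q q' : LiftedFace A b}
    (h : faceRel A b (facePoint q) (facePoint q')) (h' : faceRel A b (facePoint q') (facePoint q)) :
    q = q' := by
  have hr := faceOrder_faceRel (b := b) hA
  obtain ⟨e, v⟩ := q
  obtain ⟨e', v'⟩ := q'
  have he : e = e' := by
    apply Subtype.ext
    rw [cell_eq, cell_eq, ← image_face_add_intVec (cellPoint e) v,
      ← image_face_add_intVec (cellPoint e') v']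
    congr 1
    ext y
    exact ⟨fun hy => ⟨hr.trans h' hy.1, hr.trans hy.2 h⟩,
      fun hy => ⟨hr.trans h hy.1, hr.trans hy.2 h'⟩⟩
  subst he
  have hv : v - v' = 0 := by
    apply eq_zero_of_faceRel_add hA (b := b) (x := cellPoint e)
    rw [← faceRel_add_intVec v', add_assoc, ← intVec_add, sub_add_cancel]
    exact h
  rw [sub_eq_zero.mp hv]

instance [hA : Fact ((A.map (Int.cast : ℤ → ℝ)).rank = d)] : PartialOrder (LiftedFace A b) where
  le q q' := faceRel A b (facePoint q') (facePoint q)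
  le_refl q := (faceOrder_faceRel hA.out).refl _
  le_trans _ _ _ h h' := (faceOrder_faceRel hA.out).trans h' h
  le_antisymm _ _ h h' := facePoint_injective hA.out h' h

theorem faceSystem_facePoint [hA : Fact ((A.map (Int.cast : ℤ → ℝ)).rank = d)] :
    FaceSystem (faceRel A b) (facePoint (A := A) (b := b)) where
  le_iff _ _ := Iff.rfl
  surj x := by
    -- The chosen lift of the torus cell below `x` contains a point over the image of `x`, that is,
    -- a translate of `x`.
    set e : toricCells A b := ⟨torusProj d '' {y | SameFace A b x y}, _, ⟨x, rfl⟩, rfl⟩ with he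
    have hx : torusProj d x ∈ torusProj d '' cellLift A b e := by
      rw [image_cellLift]
      exact ⟨x, fun _ _ _ => rfl, rfl⟩
    obtain ⟨y, hy, hyx⟩ := hx
    obtain ⟨v, rfl⟩ := exists_eq_add_intVec hyx
    rw [cellLift_eq] at hy
    exact ⟨(e, v), (faceRel_add_intVec v).mpr hy.1, (faceRel_add_intVec v).mpr hy.2⟩
  finite x D := by
    refine Set.Finite.of_finite_image ((finite_floor_ceil (A := A) (b := b) x D).subset ?_)
      (f := fun q j => (⌊height A b j (facePoint q)⌋, ⌈height A b j (facePoint q)⌉)) ?_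
    · rintro _ ⟨q, hq, rfl⟩
      exact ⟨facePoint q, hq, rfl⟩
    -- Floors and ceilings of all heights determine the cell.
    · intro q _ q' _ h
      have h' : ∀ j, ⌊height A b j (facePoint q)⌋ = ⌊height A b j (facePoint q')⌋ ∧
          ⌈height A b j (facePoint q)⌉ = ⌈height A b j (facePoint q')⌉ := fun j =>
        Prod.ext_iff.mp (congrFun h j)
      refine facePoint_injective hA.out (fun j => ?_) fun j => ?_
      · rw [lineRel, ← (h' j).1, ← (h' j).2]
        exact lineRel.refl _
      · rw [lineRel, (h' j).1, (h' j).2]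
        exact lineRel.refl _

theorem closure_cellLift (hA : (A.map (Int.cast : ℤ → ℝ)).rank = d) (e : toricCells A b) :
    closure (cellLift A b e) = {x | faceRel A b x (cellPoint e)} := by
  have hr := faceOrder_faceRel (b := b) hA
  refine Set.Subset.antisymm (closure_minimal ?_ (hr.isClosed _)) fun x hx => ?_
  · rw [cellLift_eq]
    exact fun y hy => hy.2
  · set γ : ℝ → Fin d → ℝ := fun t => (1 - t) • x + t • cellPoint e with hγ
    have hc : Continuous γ := by fun_prop
    have h0 : γ 0 = x := by simp [hγ]
    refine mem_closure_of_tendsto (f := γ) (b := 𝓝[>] (0 : ℝ)) ?_ ?_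
    · rw [← h0]
      exact (hc.tendsto 0).mono_left nhdsWithin_le_nhds
    · filter_upwards [Ioc_mem_nhdsGT (zero_lt_one (α := ℝ))] with t ht
      rw [cellLift_eq]
      refine ⟨hr.interior hx t ht.1 ht.2, hr.convex _ hx (hr.refl _) ?_ ht.1.le ?_⟩
      · linarith [ht.2]
      · ring

/-! ### Faces of faces, and morphisms of the face category as translations -/

/-- A linear functional that exposes the closed face of `z` in the closed face of `y`. -/
theorem exists_exposing_functional {y z : Fin d → ℝ} (hzy : faceRel A b z y) :
    ∃ g : StrongDual ℝ (Fin d → ℝ), ∀ x, faceRel A b x y →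
      (faceRel A b x z → g x = g z) ∧ (¬ faceRel A b x z → g z < g x) := by
  classical
  -- The signs make every summand nonnegative on the closed face of `y`: `z` attains the lower bound
  -- of a height, the upper bound, both, or neither. In the last two cases the coefficient is zero
  -- and the height imposes no condition.
  set c : Fin n → ℝ := fun j => (if height A b j z = ⌊height A b j y⌋ then 1 else 0) -
    (if height A b j z = ⌈height A b j y⌉ then 1 else 0) with hc
  set gl : (Fin d → ℝ) →ₗ[ℝ] ℝ := ∑ j, c j • ∑ k, (A k j : ℝ) • LinearMap.proj k with hgl
  have hg : ∀ x, gl x - gl z = ∑ j, c j * (height A b j x - height A b j z) := by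
    intro x
    simp only [hgl, LinearMap.sum_apply, LinearMap.smul_apply, LinearMap.proj_apply, smul_eq_mul,
      height, sub_sub_sub_cancel_right, mul_sub, Finset.sum_sub_distrib]
  refine ⟨gl.toContinuousLinearMap, fun x hx => ?_⟩
  have hterm : ∀ j, 0 ≤ c j * (height A b j x - height A b j z) ∧
      (c j * (height A b j x - height A b j z) = 0 ↔ lineRel (height A b j x) (height A b j z)) := by
    intro j
    obtain ⟨h1, h2⟩ := hx j
    obtain ⟨h3, h4⟩ := hzy j
    have hint : ∀ m : ℤ, height A b j z = m →
        (lineRel (height A b j x) (height A b j z) ↔ height A b j x = height A b j z) := by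
      intro m hm
      refine ⟨fun h => ?_, fun h => by rw [h]; exact lineRel.refl _⟩
      rw [hm] at h ⊢
      exact h.eq_of_int
    by_cases hf : height A b j z = ⌊height A b j y⌋
    · by_cases he : height A b j z = ⌈height A b j y⌉
      · rw [hint _ hf]
        have : height A b j x = height A b j z := le_antisymm (he ▸ h2) (hf ▸ h1)
        simp [this]
      · rw [hint _ hf]
        simp only [hc, if_pos hf, if_neg he, sub_zero, one_mul, sub_eq_zero, iff_self, and_true,
          sub_nonneg]
        exact hf ▸ h1
    · by_cases he : height A b j z = ⌈height A b j y⌉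
      · rw [hint _ he]
        simp only [hc, if_neg hf, if_pos he, zero_sub, neg_mul, one_mul, neg_sub, sub_eq_zero,
          sub_nonneg]
        exact ⟨he ▸ h2, eq_comm⟩
      · simp only [hc, if_neg hf, if_neg he, sub_zero, zero_mul, le_refl, true_and, true_iff]
        have h5 := lineRel.of_lt (t := height A b j y) (lt_of_le_of_ne h3 (Ne.symm hf))
          (lt_of_le_of_ne h4 he)
        exact lineRel.trans (hx j) h5
  constructor
  · intro hxz
    have := hg x
    rw [Finset.sum_eq_zero fun j _ => (hterm j).2.mpr (hxz j)] at this
    exact sub_eq_zero.mp this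
  · intro hxz
    rw [faceRel, not_forall] at hxz
    obtain ⟨j, hj⟩ := hxz
    refine sub_pos.mp (lt_of_lt_of_eq ?_ (hg x).symm)
    exact Finset.sum_pos' (fun j _ => (hterm j).1)
      ⟨j, Finset.mem_univ _, lt_of_le_of_ne (hterm j).1 fun h => hj ((hterm j).2.mp h.symm)⟩

/-- The faces of a closed face `P` are faces of every closed face that contains `P`. -/
theorem isFace_of_faceRel (hA : (A.map (Int.cast : ℤ → ℝ)).rank = d) {y z : Fin d → ℝ}
    (hzy : faceRel A b z y) {S : Set (Fin d → ℝ)} (hS : IsFace {x | faceRel A b x z} S) :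
    IsFace {x | faceRel A b x y} S := by
  have : Fact ((A.map (Int.cast : ℤ → ℝ)).rank = d) := ⟨hA⟩
  have hr := faceOrder_faceRel (b := b) hA
  have hp := faceSystem_facePoint (A := A) (b := b)
  obtain ⟨hne, hexp⟩ := hS
  obtain ⟨l, hl⟩ := hexp hne
  obtain ⟨x₀, hx₀⟩ := hne
  have hx₀' := hx₀
  rw [hl] at hx₀'
  obtain ⟨hx₀z, hmax⟩ := hx₀'
  obtain ⟨g, hg⟩ := exists_exposing_functional hzy
  have hfin := hp.finite_le hr y
  -- Off the face of `z` the functional `l` may exceed its maximum on that face. Subtracting a large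
  -- multiple of `g` corrects this at the finitely many chosen points, and the extra `1` in `C + 1`
  -- makes the inequality strict.
  obtain ⟨C, hC⟩ := (hfin.image fun q =>
    (l (facePoint q) - l x₀) / (g (facePoint q) - g z)).bddAbove
  have hC' : ∀ q : LiftedFace A b, faceRel A b (facePoint q) y → ¬ faceRel A b (facePoint q) z →
      l (facePoint q) - l x₀ < (C + 1) * (g (facePoint q) - g z) := by
    intro q hq hqz
    have h1 := hC ⟨q, hq, rfl⟩
    have h2 := sub_pos.mpr ((hg _ hq).2 hqz)
    rw [← div_lt_iff₀ h2]
    exact lt_of_le_of_lt h1 (lt_add_one C)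
  have hin : ∀ x, faceRel A b x z → (l - (C + 1) • g) x = l x - (C + 1) * g z := by
    intro x hx
    simp [(hg x (hr.trans hx hzy)).1 hx]
  have hlt : ∀ x, faceRel A b x y → ¬ faceRel A b x z →
      (l - (C + 1) • g) x < l x₀ - (C + 1) * g z := by
    intro x hx hxz
    -- Barycentric coordinates reduce the estimate to chosen points; the largest cell of positive
    -- weight gives the strict term, since it contains `x` and so is not part of the closed face of
    -- `z`.
    obtain ⟨W, hW, rfl⟩ := hp.exists_coord hr x
    obtain ⟨q, hq, hmin⟩ := hW.exists_top
    obtain ⟨h1, h2⟩ := hp.linearCombination_mem_cell hr hW.nonneg hW.total hq hmin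
    have hle : ∀ q' ∈ W.support, faceRel A b (facePoint q') y := fun q' hq' =>
      hr.trans ((hp.le_iff _ _).mp (hmin q' hq')) (hr.trans h2 hx)
    have htot := hW.total
    rw [totalMass_eq_sum] at htot
    rw [Finsupp.linearCombination_apply, Finsupp.sum, map_sum]
    simp_rw [map_smul, smul_eq_mul]
    rw [show l x₀ - (C + 1) * g z = ∑ q ∈ W.support, W q * (l x₀ - (C + 1) * g z) by
      rw [← Finset.sum_mul, htot, one_mul]]
    have hpt : ∀ q : LiftedFace A b, faceRel A b (facePoint q) y → ¬ faceRel A b (facePoint q) z →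
        (l - (C + 1) • g) (facePoint q) < l x₀ - (C + 1) * g z := by
      intro q hq hqz
      have := hC' q hq hqz
      simp only [sub_apply, smul_apply, smul_eq_mul]
      linarith
    refine Finset.sum_lt_sum (fun q' hq' => ?_)
      ⟨q, Finsupp.mem_support_iff.mpr hq.ne', mul_lt_mul_of_pos_left (hpt q ?_ ?_) hq⟩
    · refine mul_le_mul_of_nonneg_left ?_ (hW.nonneg q')
      by_cases hqz : faceRel A b (facePoint q') z
      · rw [hin _ hqz]
        have := hmax _ hqz
        linarith
      · exact (hpt q' (hle q' hq') hqz).le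
    · exact hr.trans h2 hx
    · exact fun h => hxz (hr.trans h1 h)
  refine ⟨⟨x₀, hx₀⟩, fun _ => ⟨l - (C + 1) • g, ?_⟩⟩
  ext x
  constructor
  · intro hx
    rw [hl] at hx
    refine ⟨hr.trans hx.1 hzy, fun w hw => ?_⟩
    have h1 : l x₀ ≤ l x := hx.2 _ hx₀z
    rw [hin x hx.1]
    by_cases hwz : faceRel A b w z
    · rw [hin w hwz]
      linarith [hx.2 w hwz]
    · linarith [hlt w hw hwz]
  · rintro ⟨hxy, hx⟩
    have h1 := hx x₀ (hr.trans hx₀z hzy)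
    rw [hin x₀ hx₀z] at h1
    by_cases hxz : faceRel A b x z
    · rw [hin x hxz] at h1
      rw [hl]
      exact ⟨hxz, fun w hw => (hmax w hw).trans (by linarith)⟩
    · exact absurd h1 (not_le.mpr (hlt x hxy hxz))

theorem polytope_eq (hA : (A.map (Int.cast : ℤ → ℝ)).rank = d) (e : toricCells A b) :
    (toricComplex A b).polytope e = {x | faceRel A b x (cellPoint e)} := closure_cellLift hA e

/-- Compatibility with the characteristic maps makes `f x - x` an integer vector; it depends
continuously on `x` in a convex polytope, hence is constant. -/
theorem FaceHom.exists_vec [hA : Fact ((A.map (Int.cast : ℤ → ℝ)).rank = d)]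
    {e e' : toricCells A b} (f : FaceHom (toricComplex A b) e e') :
    ∃ v : Fin d → ℤ, ∀ x, (f.toFun x : Fin d → ℝ) = x + intVec v := by
  have hr := faceOrder_faceRel (b := b) hA.out
  have hconn : PreconnectedSpace ((toricComplex A b).polytope e) := by
    rw [← isPreconnected_iff_preconnectedSpace, polytope_eq hA.out]
    exact (hr.convex _).isPreconnected
  have h : ∀ x, ∃ v : Fin d → ℤ, (f.toFun x : Fin d → ℝ) = x + intVec v := fun x =>
    exists_eq_add_intVec (f.comp_char x).symm
  choose v hv using h
  have x₀ : (toricComplex A b).polytope e := ⟨cellPoint e, by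
    rw [polytope_eq hA.out]; exact hr.refl _⟩
  refine ⟨v x₀, fun x => ?_⟩
  suffices v x = v x₀ by rw [hv x, this]
  funext k
  have hcont : Continuous fun x => ((v x k : ℤ) : ℝ) := by
    have : (fun x => ((v x k : ℤ) : ℝ)) = fun x => (f.toFun x : Fin d → ℝ) k - x.1 k := by
      funext x
      rw [hv x]
      simp [intVec]
    rw [this]
    exact ((continuous_apply k).comp (continuous_subtype_val.comp f.isEmbedding.continuous)).sub
      ((continuous_apply k).comp continuous_subtype_val)
  have hcont' : Continuous fun x => v x k := Int.isClosedEmbedding_coe_real.isInducing.continuous_iff.mpr hcont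
  exact PreconnectedSpace.constant hconn hcont'

/-- The integer vector by which a morphism of the face category translates. -/
def FaceHom.vec [Fact ((A.map (Int.cast : ℤ → ℝ)).rank = d)]
    {e e' : toricCells A b} (f : FaceHom (toricComplex A b) e e') : Fin d → ℤ :=
  f.exists_vec.choose

section

variable [hA : Fact ((A.map (Int.cast : ℤ → ℝ)).rank = d)] {e e' : toricCells A b}

theorem FaceHom.toFun_eq (f : FaceHom (toricComplex A b) e e') (x) :
    (f.toFun x : Fin d → ℝ) = x + intVec f.vec := f.exists_vec.choose_spec x

theorem mem_polytope_iff {x : Fin d → ℝ} :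
    x ∈ (toricComplex A b).polytope e ↔ faceRel A b x (cellPoint e) := by
  rw [polytope_eq hA.out]
  rfl

theorem cellPoint_mem (e : toricCells A b) : cellPoint e ∈ (toricComplex A b).polytope e := by
  rw [polytope_eq hA.out]
  exact (faceOrder_faceRel hA.out).refl _

theorem FaceHom.vec_eq {f : FaceHom (toricComplex A b) e e'} {v : Fin d → ℤ}
    (h : ∀ x, (f.toFun x : Fin d → ℝ) = x + intVec v) : f.vec = v := by
  have := (f.toFun_eq ⟨_, cellPoint_mem e⟩).symm.trans (h ⟨_, cellPoint_mem e⟩)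
  exact intVec_injective (add_left_cancel this)

theorem FaceHom.ext_vec {f g : FaceHom (toricComplex A b) e e'} (h : f.vec = g.vec) : f = g := by
  ext x : 2
  apply Subtype.ext
  rw [f.toFun_eq, g.toFun_eq, h]

theorem FaceHom.faceRel_vec (f : FaceHom (toricComplex A b) e e') :
    faceRel A b (cellPoint e + intVec f.vec) (cellPoint e') := by
  have h := (f.toFun ⟨_, cellPoint_mem e⟩).2
  rwa [mem_polytope_iff, f.toFun_eq] at h

/-- The translation of a polytope into another one by an integer vector. -/
def translatePolytope (v : Fin d → ℤ) (h : faceRel A b (cellPoint e + intVec v) (cellPoint e'))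
    (x : (toricComplex A b).polytope e) : (toricComplex A b).polytope e' :=
  ⟨x + intVec v, mem_polytope_iff.mpr ((faceOrder_faceRel hA.out).trans
    ((faceRel_add_intVec v).mpr (mem_polytope_iff.mp x.2)) h)⟩

/-- The morphism of the face category given by an integer translation. -/
def FaceHom.ofVec (v : Fin d → ℤ) (h : faceRel A b (cellPoint e + intVec v) (cellPoint e')) :
    FaceHom (toricComplex A b) e e' where
  toFun := translatePolytope v h
  isEmbedding := by
    have hc : Continuous (translatePolytope v h) :=
      Continuous.subtype_mk (continuous_subtype_val.add continuous_const) _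
    refine IsEmbedding.of_comp (g := Subtype.val) hc continuous_subtype_val ?_
    exact (Homeomorph.addRight (intVec v)).isEmbedding.comp IsEmbedding.subtypeVal
  map_face S hS := by
    have hsub : S ⊆ (toricComplex A b).polytope e := hS.2.subset
    have himg : Subtype.val '' (translatePolytope v h '' (Subtype.val ⁻¹' S)) =
        (fun x => x + intVec v) '' S := by
      ext x
      constructor
      · rintro ⟨_, ⟨w, hw, rfl⟩, rfl⟩
        exact ⟨w, hw, rfl⟩
      · rintro ⟨w, hw, rfl⟩
        exact ⟨_, ⟨⟨w, hsub hw⟩, hw, rfl⟩, rfl⟩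
    rw [himg, polytope_eq hA.out]
    refine isFace_of_faceRel hA.out h ?_
    rw [polytope_eq hA.out] at hS
    obtain ⟨hne, hexp⟩ := hS
    refine ⟨hne.image _, fun _ => ?_⟩
    obtain ⟨l, hl⟩ := hexp hne
    refine ⟨l, ?_⟩
    ext x
    obtain ⟨x, rfl⟩ : ∃ y, x = y + intVec v := ⟨x - intVec v, by simp⟩
    rw [(add_left_injective (intVec v)).mem_set_image (s := S), hl]
    simp only [Set.mem_ofPred_eq, faceRel_add_intVec]
    refine and_congr_right fun _ => ⟨fun hx w hw => ?_, fun hx w hw => ?_⟩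
    · obtain ⟨w, rfl⟩ : ∃ y, w = y + intVec v := ⟨w - intVec v, by simp⟩
      rw [faceRel_add_intVec] at hw
      simpa using hx w hw
    · simpa using hx (w + intVec v) ((faceRel_add_intVec v).mpr hw)
  comp_char x := torusProj_add_intVec _ _

theorem FaceHom.vec_ofVec (v : Fin d → ℤ)
    (h : faceRel A b (cellPoint e + intVec v) (cellPoint e')) : (FaceHom.ofVec v h).vec = v :=
  FaceHom.vec_eq fun _ => rfl

end

/-! ### The pair category and its covering by a partially ordered set -/

/-- The pairs of points of `ℝᵈ` that do not both lie on lifts of the same hypersurface. -/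
def avoidSet (A : Matrix (Fin d) (Fin n) ℤ) (b : Fin n → UnitAddCircle) :
    Set ((Fin d → ℝ) × (Fin d → ℝ)) :=
  {z | ∀ j, ¬ ((∃ m : ℤ, height A b j z.1 = m) ∧ ∃ m : ℤ, height A b j z.2 = m)}

/-- The face order of the product of two copies of the lifted arrangement. -/
def pairRel (A : Matrix (Fin d) (Fin n) ℤ) (b : Fin n → UnitAddCircle)
    (x y : (Fin d → ℝ) × (Fin d → ℝ)) : Prop := faceRel A b x.1 y.1 ∧ faceRel A b x.2 y.2

/-- An integral height at `y` is constant on the closed cell of `y`, in particular equal at `x`.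
Thus `avoidSet A b` can serve as the set `M` of the retraction. -/
theorem mem_avoidSet_of_pairRel (x y : (Fin d → ℝ) × (Fin d → ℝ)) (h : pairRel A b x y)
    (hx : x ∈ avoidSet A b) : y ∈ avoidSet A b := by
  rintro j ⟨⟨m, hm⟩, ⟨m', hm'⟩⟩
  refine hx j ⟨⟨m, ?_⟩, ⟨m', ?_⟩⟩
  · have := h.1 j
    rw [hm] at this
    exact this.eq_of_int
  · have := h.2 j
    rw [hm'] at this
    exact this.eq_of_int

/-- The real vectors of a pair of integer vectors. -/
def pairIntVec (v : (Fin d → ℤ) × (Fin d → ℤ)) : (Fin d → ℝ) × (Fin d → ℝ) :=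
  (intVec v.1, intVec v.2)

theorem exists_int_height_add {j : Fin n} {x : Fin d → ℝ} {v : Fin d → ℤ} :
    (∃ m : ℤ, height A b j (x + intVec v) = m) ↔ ∃ m : ℤ, height A b j x = m := by
  rw [height_add_intVec]
  constructor
  · rintro ⟨m, hm⟩
    exact ⟨m - ∑ k, A k j * v k, by rw [Int.cast_sub, ← hm, add_sub_cancel_right]⟩
  · rintro ⟨m, hm⟩
    exact ⟨m + ∑ k, A k j * v k, by rw [Int.cast_add, hm]⟩

theorem add_mem_avoidSet_iff (v : (Fin d → ℤ) × (Fin d → ℤ)) (z : (Fin d → ℝ) × (Fin d → ℝ)) :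
    z + pairIntVec v ∈ avoidSet A b ↔ z ∈ avoidSet A b := by
  simp only [avoidSet, pairIntVec, Set.mem_ofPred_eq, Prod.fst_add, Prod.snd_add,
    exists_int_height_add]

theorem torusProj_mem_iff {j : Fin n} {x : Fin d → ℝ} :
    torusProj d x ∈ toricHypersurface A b j ↔ ∃ m : ℤ, height A b j x = m := by
  have h : ∑ k, A k j • torusProj d x k = ((∑ k, (A k j : ℝ) * x k : ℝ) : UnitAddCircle) := by
    have := map_sum (QuotientAddGroup.mk' (AddSubgroup.zmultiples (1 : ℝ)))
      (fun k => (A k j : ℝ) * x k) Finset.univ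
    refine Eq.trans ?_ this.symm
    refine Finset.sum_congr rfl fun k _ => ?_
    rw [← zsmul_eq_mul]
    exact (map_zsmul (QuotientAddGroup.mk' (AddSubgroup.zmultiples (1 : ℝ))) (A k j) (x k)).symm
  rw [toricHypersurface, Set.mem_ofPred_eq, h, ← coe_constLift b j, eq_comm]
  refine QuotientAddGroup.eq.trans (AddSubgroup.mem_zmultiples_iff.trans ?_)
  refine exists_congr fun m => ?_
  rw [height, zsmul_one, eq_comm, neg_add_eq_sub]

theorem pairIntVec_add (v w : (Fin d → ℤ) × (Fin d → ℤ)) :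
    pairIntVec (v + w) = pairIntVec v + pairIntVec w :=
  Prod.ext (intVec_add _ _) (intVec_add _ _)

theorem pairRel_add_iff {x y : (Fin d → ℝ) × (Fin d → ℝ)} (v : (Fin d → ℤ) × (Fin d → ℤ)) :
    pairRel A b (x + pairIntVec v) (y + pairIntVec v) ↔ pairRel A b x y :=
  and_congr (faceRel_add_intVec _) (faceRel_add_intVec _)

/-- The chosen points of pairs of faces. -/
def pairPoint (q : LiftedFace A b × LiftedFace A b) : (Fin d → ℝ) × (Fin d → ℝ) :=
  Prod.map facePoint facePoint q

theorem pairPoint_mem_iff {q : LiftedFace A b × LiftedFace A b} :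
    pairPoint q ∈ avoidSet A b ↔ (cellPoint q.1.1, cellPoint q.2.1) ∈ avoidSet A b :=
  add_mem_avoidSet_iff (q.1.2, q.2.2) (cellPoint q.1.1, cellPoint q.2.1)

/-- The translation of pairs of lifted faces. -/
def translate (v : (Fin d → ℤ) × (Fin d → ℤ)) (q : LiftedFace A b × LiftedFace A b) :
    LiftedFace A b × LiftedFace A b := ((q.1.1, q.1.2 + v.1), (q.2.1, q.2.2 + v.2))

theorem pairPoint_translate (v : (Fin d → ℤ) × (Fin d → ℤ))
    (q : LiftedFace A b × LiftedFace A b) :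
    pairPoint (translate v q) = pairPoint q + pairIntVec v := by
  apply Prod.ext
  · exact (congrArg (cellPoint q.1.1 + ·) (intVec_add q.1.2 v.1)).trans (add_assoc _ _ _).symm
  · exact (congrArg (cellPoint q.2.1 + ·) (intVec_add q.2.2 v.2)).trans (add_assoc _ _ _).symm

section

variable [hA : Fact ((A.map (Int.cast : ℤ → ℝ)).rank = d)]

/-- Integrality of a height does not vary within an open cell, so the base point decides. -/
theorem mem_supp_iff {F : ToricFaceCategory A b} {j : Fin n} :
    toricHypersurface A b j ∈ supp A b F ↔ ∃ m : ℤ, height A b j (cellPoint F) = m := by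
  have hr := faceOrder_faceRel (b := b) hA.out
  have hcell : openCell A b F = torusProj d ''
    {y | faceRel A b (cellPoint F) y ∧ faceRel A b y (cellPoint F)} := cell_eq F
  constructor
  · intro h
    refine torusProj_mem_iff.mp (h.2 ?_)
    rw [hcell]
    exact ⟨_, ⟨hr.refl _, hr.refl _⟩, rfl⟩
  · rintro ⟨m, hm⟩
    refine ⟨⟨j, rfl⟩, ?_⟩
    rw [hcell]
    rintro _ ⟨y, hy, rfl⟩
    refine torusProj_mem_iff.mpr ⟨m, ?_⟩
    have := hy.2 j
    rw [hm] at this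
    exact this.eq_of_int

theorem disjointSupports_iff (P : (ToricFaceCategory A b)ᵒᵖ × (ToricFaceCategory A b)ᵒᵖ) :
    disjointSupports A b P ↔ (cellPoint P.1.unop, cellPoint P.2.unop) ∈ avoidSet A b := by
  rw [disjointSupports, Set.eq_empty_iff_forall_notMem]
  constructor
  · intro h j hj
    exact h _ ⟨mem_supp_iff.mpr hj.1, mem_supp_iff.mpr hj.2⟩
  · rintro h H ⟨h1, h2⟩
    obtain ⟨j, rfl⟩ := h1.1
    exact h j ⟨mem_supp_iff.mp h1, mem_supp_iff.mp h2⟩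

variable (A b) in
/-- The pairs of faces of the lifted arrangement whose supports in the torus are disjoint. -/
abbrev LiftedPair : Type := {q : LiftedFace A b × LiftedFace A b // pairPoint q ∈ avoidSet A b}

theorem faceOrder_pairRel : FaceOrder (pairRel A b) :=
  (faceOrder_faceRel hA.out).prod (faceOrder_faceRel hA.out)

theorem faceSystem_pairPoint : FaceSystem (pairRel A b) (pairPoint (A := A) (b := b)) :=
  faceSystem_facePoint.prod faceSystem_facePoint

/-- The pair of integer vectors by which a morphism of the pair category translates. -/
def pairVec {X Y : PairCategory A b} (f : X ⟶ Y) : (Fin d → ℤ) × (Fin d → ℤ) :=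
  (FaceHom.vec f.hom.1.unop, FaceHom.vec f.hom.2.unop)

/-- Morphisms are translations, so equations between morphisms become equations between integer
vectors. -/
theorem pairVec_injective {X Y : PairCategory A b} {f g : X ⟶ Y} (h : pairVec f = pairVec g) :
    f = g := by
  apply InducedCategory.hom_ext
  apply Prod.ext
  · apply Quiver.Hom.unop_inj
    exact FaceHom.ext_vec (Prod.ext_iff.mp h).1
  · apply Quiver.Hom.unop_inj
    exact FaceHom.ext_vec (Prod.ext_iff.mp h).2

theorem FaceHom.vec_id (F : ToricFaceCategory A b) : FaceHom.vec (𝟙 F) = 0 :=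
  FaceHom.vec_eq fun x => by rw [intVec_zero, add_zero]; rfl

theorem FaceHom.vec_comp {F G H : ToricFaceCategory A b} (f : F ⟶ G) (g : G ⟶ H) :
    FaceHom.vec (f ≫ g) = FaceHom.vec f + FaceHom.vec g :=
  FaceHom.vec_eq fun x => (FaceHom.toFun_eq g (FaceHom.toFun f x)).trans (by
    rw [FaceHom.toFun_eq f x, intVec_add, add_assoc])

theorem pairVec_id (X : PairCategory A b) : pairVec (𝟙 X) = 0 :=
  Prod.ext (FaceHom.vec_id X.obj.1.unop) (FaceHom.vec_id X.obj.2.unop)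

theorem pairVec_comp {X Y Z : PairCategory A b} (f : X ⟶ Y) (g : Y ⟶ Z) :
    pairVec (f ≫ g) = pairVec f + pairVec g := by
  apply Prod.ext
  · exact (FaceHom.vec_comp g.hom.1.unop f.hom.1.unop).trans (add_comm _ _)
  · exact (FaceHom.vec_comp g.hom.2.unop f.hom.2.unop).trans (add_comm _ _)

theorem pairVec_eqToHom {X Y : PairCategory A b} (h : X = Y) : pairVec (eqToHom h) = 0 := by
  subst h
  exact pairVec_id X

/-- An `eqToHom` has vector zero, so the transport morphisms of functor extensionality vanish on
passing to vectors. -/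
theorem functor_ext_of_pairVec {J : Type*} [Category J] {F G : J ⥤ PairCategory A b}
    (h : ∀ i, F.obj i = G.obj i)
    (h' : ∀ {i j : J} (f : i ⟶ j), pairVec (F.map f) = pairVec (G.map f)) : F = G :=
  CategoryTheory.Functor.ext h fun i j f => pairVec_injective (by
    rw [pairVec_comp, pairVec_comp, pairVec_eqToHom, pairVec_eqToHom, zero_add, add_zero, h' f])

/-- The base points of the two polytopes of an object of the pair category. -/
def basePoint (X : PairCategory A b) : (Fin d → ℝ) × (Fin d → ℝ) :=
  (cellPoint X.obj.1.unop, cellPoint X.obj.2.unop)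

theorem pairRel_pairVec {X Y : PairCategory A b} (f : X ⟶ Y) :
    pairRel A b (basePoint Y + pairIntVec (pairVec f)) (basePoint X) :=
  ⟨FaceHom.faceRel_vec f.hom.1.unop, FaceHom.faceRel_vec f.hom.2.unop⟩

theorem exists_hom_of_pairRel {X Y : PairCategory A b} (v : (Fin d → ℤ) × (Fin d → ℤ))
    (h : pairRel A b (basePoint Y + pairIntVec v) (basePoint X)) :
    ∃ f : X ⟶ Y, pairVec f = v :=
  ⟨⟨(Quiver.Hom.op (V := ToricFaceCategory A b) (FaceHom.ofVec v.1 h.1),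
    Quiver.Hom.op (V := ToricFaceCategory A b) (FaceHom.ofVec v.2 h.2))⟩,
    Prod.ext (FaceHom.vec_ofVec _ _) (FaceHom.vec_ofVec _ _)⟩

/-- The object of the pair category under a pair of lifted faces. -/
def LiftedPair.base (q : LiftedPair A b) : PairCategory A b :=
  ⟨(Opposite.op (show ToricFaceCategory A b from q.1.1.1),
    Opposite.op (show ToricFaceCategory A b from q.1.2.1)),
    (disjointSupports_iff _).mpr (pairPoint_mem_iff.mp q.2)⟩

/-- The translation part of a pair of lifted faces. -/
def LiftedPair.shift (q : LiftedPair A b) : (Fin d → ℤ) × (Fin d → ℤ) := (q.1.1.2, q.1.2.2)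

theorem LiftedPair.ext {q q' : LiftedPair A b} (h : q.base = q'.base) (h' : q.shift = q'.shift) :
    q = q' := by
  have h1 : q.base.obj = q'.base.obj := congrArg _ h
  obtain ⟨e1, e2⟩ := Prod.ext_iff.mp h1
  obtain ⟨v1, v2⟩ := Prod.ext_iff.mp h'
  exact Subtype.ext (Prod.ext (Prod.ext (congrArg Opposite.unop e1) v1)
    (Prod.ext (congrArg Opposite.unop e2) v2))

theorem LiftedPair.le_iff {q q' : LiftedPair A b} : q ≤ q' ↔
    pairRel A b (basePoint q'.base + pairIntVec (q'.shift - q.shift)) (basePoint q.base) := by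
  rw [← pairRel_add_iff q.shift, add_assoc, ← pairIntVec_add, sub_add_cancel]
  exact Iff.rfl

/-- The object of the lifted poset with given base and translation part. -/
def LiftedPair.mk (X : PairCategory A b) (v : (Fin d → ℤ) × (Fin d → ℤ)) : LiftedPair A b :=
  ⟨((X.obj.1.unop, v.1), (X.obj.2.unop, v.2)),
    pairPoint_mem_iff.mpr ((disjointSupports_iff _).mp X.property)⟩

theorem pairPoint_eq (q : LiftedPair A b) :
    pairPoint q.1 = basePoint q.base + pairIntVec q.shift := rfl

/-- The morphism of the pair category under a relation of the lifted poset. -/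
def LiftedPair.hom {q q' : LiftedPair A b} (h : q ≤ q') : q.base ⟶ q'.base :=
  (exists_hom_of_pairRel _ (LiftedPair.le_iff.mp h)).choose

theorem LiftedPair.pairVec_hom {q q' : LiftedPair A b} (h : q ≤ q') :
    pairVec (LiftedPair.hom h) = q'.shift - q.shift :=
  (exists_hom_of_pairRel _ (LiftedPair.le_iff.mp h)).choose_spec

/-- The covering of the pair category by the poset of pairs of lifted faces. -/
def pairFunctor : LiftedPair A b ⥤ PairCategory A b where
  obj q := q.base
  map f := LiftedPair.hom f.le
  map_id q := pairVec_injective (by rw [LiftedPair.pairVec_hom, sub_self, pairVec_id])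
  map_comp f g := pairVec_injective (by
    rw [pairVec_comp, LiftedPair.pairVec_hom, LiftedPair.pairVec_hom, LiftedPair.pairVec_hom]
    abel)

theorem pairVec_pairFunctor_map {q q' : LiftedPair A b} (f : q ⟶ q') :
    pairVec (pairFunctor.map f) = q'.shift - q.shift := LiftedPair.pairVec_hom f.le

theorem eq_zero_of_pairRel_add {x : (Fin d → ℝ) × (Fin d → ℝ)} {v : (Fin d → ℤ) × (Fin d → ℤ)}
    (h : pairRel A b (x + pairIntVec v) x) : v = 0 :=
  Prod.ext (eq_zero_of_faceRel_add hA.out h.1) (eq_zero_of_faceRel_add hA.out h.2)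

/-- An endomorphism translates a closed cell into itself, so its vector is zero by freeness. An
isomorphism and its inverse give opposite inequalities between two elements of the covering poset.
-/
theorem isAcyclicCategory_pairCategory : IsAcyclicCategory (PairCategory A b) where
  eq_id {X} f := pairVec_injective (by
    rw [pairVec_id]
    exact eq_zero_of_pairRel_add (pairRel_pairVec f))
  eq_of_isIso {X Y} f hf := by
    have h1 : LiftedPair.mk X 0 ≤ LiftedPair.mk Y (pairVec f) := by
      rw [LiftedPair.le_iff]
      have := pairRel_pairVec f
      rwa [← sub_zero (pairVec f)] at this
    have h2 : LiftedPair.mk Y (pairVec f) ≤ LiftedPair.mk X 0 := by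
      rw [LiftedPair.le_iff]
      have := pairRel_pairVec (inv f)
      rwa [show pairVec (inv f) = 0 - pairVec f by
        rw [eq_sub_iff_add_eq, ← pairVec_comp, IsIso.inv_hom_id, pairVec_id]] at this
    exact congrArg LiftedPair.base (le_antisymm h1 h2)

/-! ### Chains in the pair category and in its covering poset -/

theorem isNonIdentity_pairFunctor_map {q q' : LiftedPair A b} (h : q < q') (f : q ⟶ q') :
    IsNonIdentity (pairFunctor.map f) := by
  rintro ⟨e, he⟩
  have h0 := pairVec_pairFunctor_map f
  rw [he, pairVec_eqToHom] at h0
  exact h.ne (LiftedPair.ext e (sub_eq_zero.mp h0.symm).symm)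

/-- The chain in the pair category under a strict chain in the covering poset. -/
def projChain {k : ℕ} (σ : Fin (k + 1) → LiftedPair A b) (hσ : StrictMono σ) :
    Chain (PairCategory A b) k :=
  ⟨hσ.monotone.functor ⋙ pairFunctor, fun i =>
    isNonIdentity_pairFunctor_map (hσ (Fin.castSucc_lt_succ (i := i)))
      (homOfLE (hσ (Fin.castSucc_lt_succ (i := i))).le)⟩

theorem pairVec_projChain_map {k : ℕ} (σ : Fin (k + 1) → LiftedPair A b) (hσ : StrictMono σ)
    {i j : Fin (k + 1)} (f : i ⟶ j) :
    pairVec ((projChain σ hσ).1.map f) = (σ j).shift - (σ i).shift :=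
  pairVec_pairFunctor_map (hσ.monotone.functor.map f)

/-- The map of a simplex into the realization. -/
def realize (_k : ℕ) (σ : Fin (_k + 1) → LiftedPair A b) (hσ : StrictMono σ)
    (t : stdSimplex ℝ (Fin (_k + 1))) : Realization (PairCategory A b) :=
  Quot.mk _ ⟨⟨_k, projChain σ hσ⟩, t⟩

theorem isChainMap_realize : IsChainMap (realize (A := A) (b := b)) where
  continuous k σ hσ := continuous_quot_mk.comp
    (continuous_sigmaMk (σ := fun γ : Σ n : ℕ, Chain (PairCategory A b) n =>
      stdSimplex ℝ (Fin (γ.1 + 1))) (i := ⟨k, projChain σ hσ⟩))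
  face _ σ hσ i t := (Quot.sound (Glue.face (projChain σ hσ) i _ rfl t)).symm

theorem translate_strictMono (v : (Fin d → ℤ) × (Fin d → ℤ)) :
    StrictMono (translate (A := A) (b := b) v) := by
  have hle : ∀ q q', translate (A := A) (b := b) v q ≤ translate v q' ↔ q ≤ q' := by
    intro q q'
    rw [faceSystem_pairPoint.le_iff, faceSystem_pairPoint.le_iff, pairPoint_translate,
      pairPoint_translate, pairRel_add_iff]
  exact strictMono_of_le_iff_le fun q q' => (hle q q').symm

/-- Translation changes neither the bases nor the differences of shifts, and these determine the
chain downstairs. -/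
theorem realize_translate (v : (Fin d → ℤ) × (Fin d → ℤ)) (k : ℕ)
    (σ : Fin (k + 1) → LiftedPair A b) (hσ : StrictMono σ) (t : stdSimplex ℝ (Fin (k + 1)))
    (τ : Fin (k + 1) → LiftedPair A b) (hτ : StrictMono τ)
    (h : ∀ i, (τ i).1 = translate v (σ i).1) : realize k τ hτ t = realize k σ hσ t := by
  have hb : ∀ i, (τ i).base = (σ i).base := by
    intro i
    have : τ i = ⟨translate v (σ i).1, by rw [← h i]; exact (τ i).2⟩ := Subtype.ext (h i)
    rw [this]
    rfl
  have hs : ∀ i, (τ i).shift = (σ i).shift + v := by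
    intro i
    rw [LiftedPair.shift, h i]
    rfl
  have hchain : projChain τ hτ = projChain σ hσ := by
    apply Subtype.ext
    refine functor_ext_of_pairVec (fun i => hb i) fun {i j} f => ?_
    refine (pairVec_projChain_map τ hτ f).trans
      (Eq.trans ?_ (pairVec_projChain_map σ hσ f).symm)
    rw [hs, hs]
    abel
  rw [realize, realize, hchain]

/-- The lift to the covering poset of a sequence of composable morphisms. -/
def liftChain {k : ℕ} (γ : ComposableArrows (PairCategory A b) k) (i : Fin (k + 1)) :
    LiftedPair A b :=
  LiftedPair.mk (γ.obj i) (pairVec (γ.map (homOfLE (Fin.zero_le i))))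

theorem shift_liftChain {k : ℕ} (γ : ComposableArrows (PairCategory A b) k) {i j : Fin (k + 1)}
    (h : i ≤ j) : (liftChain γ j).shift = (liftChain γ i).shift + pairVec (γ.map (homOfLE h)) := by
  change pairVec _ = pairVec _ + _
  rw [← pairVec_comp, ← γ.map_comp]
  rfl

theorem monotone_liftChain {k : ℕ} (γ : ComposableArrows (PairCategory A b) k) :
    Monotone (liftChain γ) := by
  intro i j h
  rw [LiftedPair.le_iff, shift_liftChain γ h, add_sub_cancel_left]
  exact pairRel_pairVec (γ.map (homOfLE h))

/-- Equal consecutive lifts would have equal bases and a connecting vector zero, that is, an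
identity morphism. -/
theorem strictMono_liftChain {k : ℕ} (γ : Chain (PairCategory A b) k) :
    StrictMono (liftChain γ.1) := by
  rw [Fin.strictMono_iff_lt_succ]
  intro i
  refine lt_of_le_of_ne (monotone_liftChain γ.1 Fin.castSucc_lt_succ.le) fun h => γ.2 i ?_
  have e : γ.1.obj i.castSucc = γ.1.obj i.succ := congrArg LiftedPair.base h
  refine ⟨e, pairVec_injective ?_⟩
  have := shift_liftChain γ.1 (Fin.castSucc_lt_succ (i := i)).le
  rw [← h] at this
  rw [pairVec_eqToHom]
  exact left_eq_add.mp this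

theorem projChain_liftChain {k : ℕ} (γ : Chain (PairCategory A b) k) :
    projChain (liftChain γ.1) (strictMono_liftChain γ) = γ := by
  apply Subtype.ext
  refine functor_ext_of_pairVec (fun i => rfl) fun {i j} f => ?_
  refine (pairVec_projChain_map _ _ f).trans ?_
  exact sub_eq_of_eq_add' (shift_liftChain γ.1 f.le)

/-- The lift of a chain starts at shift zero, so omitting vertex `0` renormalizes it; the
discrepancy is the shift of the first remaining vertex. -/
theorem pairPoint_liftChain_chainFace {k : ℕ} (γ : ComposableArrows (PairCategory A b) (k + 1))
    (i : Fin (k + 2)) : ∃ v, ∀ j, pairPoint (liftChain γ (i.succAbove j)).1 =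
      pairPoint (liftChain (chainFace i γ) j).1 + pairIntVec v := by
  refine ⟨(liftChain γ (i.succAbove 0)).shift, fun j => ?_⟩
  have h : i.succAbove 0 ≤ i.succAbove j := (Fin.strictMono_succAbove i).monotone (Fin.zero_le j)
  have hs : (liftChain γ (i.succAbove j)).shift =
      (liftChain (chainFace i γ) j).shift + (liftChain γ (i.succAbove 0)).shift := by
    rw [shift_liftChain γ h, add_comm]
    rfl
  rw [pairPoint_eq, pairPoint_eq, add_assoc, ← pairIntVec_add, hs]
  rfl

end

/-! ### The complement of the elliptic arrangement as a quotient -/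

/-- The real-linear parametrization `(x, y) ↦ x + ω y` of `ℂᵈ`. -/
def complexCoords (d : ℕ) (ω : ℂ) : ((Fin d → ℝ) × (Fin d → ℝ)) →ₗ[ℝ] (Fin d → ℂ) where
  toFun z k := z.1 k + ω * z.2 k
  map_add' z w := by
    funext k
    simp only [Prod.fst_add, Prod.snd_add, Pi.add_apply]
    push_cast
    ring
  map_smul' c z := by
    funext k
    simp only [Prod.smul_fst, Prod.smul_snd, Pi.smul_apply, smul_eq_mul, RingHom.id_apply,
      Complex.real_smul]
    push_cast
    ring

theorem complexCoords_surjective {ω : ℂ} (hω : ω.im ≠ 0) :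
    Function.Surjective (complexCoords d ω) := by
  intro c
  refine ⟨(fun k => (c k).re - (c k).im / ω.im * ω.re, fun k => (c k).im / ω.im), ?_⟩
  funext k
  apply Complex.ext
  · simp [complexCoords, mul_comm]
  · simp [complexCoords, mul_div_cancel₀ _ hω]

/-- The universal covering of the `d`-th power of an elliptic curve, in real coordinates. -/
def ellipticProj (d : ℕ) (ω : ℂ) (z : (Fin d → ℝ) × (Fin d → ℝ)) : Fin d → EllipticCurve ω :=
  fun k => QuotientAddGroup.mk (complexCoords d ω z k)

theorem isOpenQuotientMap_ellipticProj {ω : ℂ} (hω : ω.im ≠ 0) :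
    IsOpenQuotientMap (ellipticProj d ω) := by
  have h1 : IsOpenQuotientMap (complexCoords d ω) :=
    ⟨complexCoords_surjective hω, LinearMap.continuous_of_finiteDimensional _,
      LinearMap.isOpenMap_of_finiteDimensional _ (complexCoords_surjective hω)⟩
  have h2 : IsOpenQuotientMap (Pi.map fun _ : Fin d =>
      (QuotientAddGroup.mk : ℂ → EllipticCurve ω)) :=
    IsOpenQuotientMap.piMap fun _ => QuotientAddGroup.isOpenQuotientMap_mk
  exact h2.comp h1

theorem add_mul_mem_lattice_iff {ω : ℂ} (hω : ω.im ≠ 0) {x y : ℝ} :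
    (x : ℂ) + ω * y ∈ AddSubgroup.closure ({1, ω} : Set ℂ) ↔
      (∃ m : ℤ, x = m) ∧ ∃ m : ℤ, y = m := by
  rw [AddSubgroup.mem_closure_pair]
  constructor
  · rintro ⟨k, l, h⟩
    rw [zsmul_one, zsmul_eq_mul] at h
    have him := congrArg Complex.im h
    simp only [Complex.add_im, Complex.intCast_im, Complex.mul_im, Complex.intCast_re,
      Complex.ofReal_re, Complex.ofReal_im, zero_mul, mul_zero, add_zero, zero_add] at him
    have hy : y = l := by
      rw [mul_comm (l : ℝ)] at him
      exact (mul_left_cancel₀ hω him).symm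
    refine ⟨⟨k, ?_⟩, ⟨l, hy⟩⟩
    rw [hy, mul_comm ω] at h
    push_cast at h
    exact_mod_cast (add_right_cancel h).symm
  · rintro ⟨⟨k, rfl⟩, ⟨l, rfl⟩⟩
    exact ⟨k, l, by rw [zsmul_one, zsmul_eq_mul, mul_comm]; push_cast; rfl⟩

theorem ellipticProj_eq_iff {ω : ℂ} (hω : ω.im ≠ 0) {z w : (Fin d → ℝ) × (Fin d → ℝ)} :
    ellipticProj d ω z = ellipticProj d ω w ↔ ∃ v, w = z + pairIntVec v := by
  have h : ∀ k, ellipticProj d ω z k = ellipticProj d ω w k ↔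
      (∃ m : ℤ, w.1 k - z.1 k = m) ∧ ∃ m : ℤ, w.2 k - z.2 k = m := by
    intro k
    rw [← add_mul_mem_lattice_iff hω]
    refine QuotientAddGroup.eq.trans ?_
    rw [show -complexCoords d ω z k + complexCoords d ω w k =
      ((w.1 k - z.1 k : ℝ) : ℂ) + ω * ((w.2 k - z.2 k : ℝ) : ℂ) by
        simp only [complexCoords, LinearMap.coe_mk, AddHom.coe_mk]
        push_cast
        ring]
  rw [funext_iff]
  simp_rw [h]
  constructor
  · intro h'
    choose v hv using fun k => (h' k).1
    choose v' hv' using fun k => (h' k).2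
    exact ⟨(v, v'), Prod.ext (funext fun k => eq_add_of_sub_eq' (hv k))
      (funext fun k => eq_add_of_sub_eq' (hv' k))⟩
  · rintro ⟨v, rfl⟩ k
    exact ⟨⟨v.1 k, by simp [pairIntVec, intVec]⟩, ⟨v.2 k, by simp [pairIntVec, intVec]⟩⟩

/-- The defining expression minus its constant is `height x + ω * height y`, which is in the lattice
exactly if both heights are integral. The form `b + ω b` of the constant makes the same arrangement
appear in both coordinates. -/
theorem ellipticProj_mem_iff {ω : ℂ} (hω : ω.im ≠ 0) {z : (Fin d → ℝ) × (Fin d → ℝ)} {j : Fin n} :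
    ellipticProj d ω z ∈ ellipticHypersurface ω A b j ↔
      (∃ m : ℤ, height A b j z.1 = m) ∧ ∃ m : ℤ, height A b j z.2 = m := by
  have h1 : ∑ k, A k j • ellipticProj d ω z k =
      QuotientAddGroup.mk' (AddSubgroup.closure ({1, ω} : Set ℂ))
        (∑ k, A k j • complexCoords d ω z k) := by
    rw [map_sum]
    exact Finset.sum_congr rfl fun k _ => (map_zsmul
      (QuotientAddGroup.mk' (AddSubgroup.closure ({1, ω} : Set ℂ))) (A k j)
      (complexCoords d ω z k)).symm
  have h2 : diag ω (b j) = QuotientAddGroup.mk' (AddSubgroup.closure ({1, ω} : Set ℂ))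
      ((constLift b j : ℂ) + ω * (constLift b j : ℂ)) := by
    conv_lhs => rw [← coe_constLift b j]
    rfl
  rw [ellipticHypersurface, Set.mem_ofPred_eq, h1, h2, eq_comm, ← add_mul_mem_lattice_iff hω]
  refine QuotientAddGroup.eq.trans ?_
  rw [show -((constLift b j : ℂ) + ω * (constLift b j : ℂ)) + ∑ k, A k j • complexCoords d ω z k =
    (height A b j z.1 : ℂ) + ω * (height A b j z.2 : ℂ) by
      simp only [complexCoords, LinearMap.coe_mk, AddHom.coe_mk, height, zsmul_eq_mul]
      push_cast
      simp only [mul_add, Finset.sum_add_distrib, mul_sub, Finset.mul_sum]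
      rw [Finset.sum_congr rfl fun k _ => mul_left_comm (A k j : ℂ) ω (z.2 k)]
      ring]

theorem preimage_complement {ω : ℂ} (hω : ω.im ≠ 0) :
    ellipticProj d ω ⁻¹' {z | z ∉ ⋃₀ ellipticArrangement ω A b} = avoidSet A b := by
  ext z
  simp only [Set.mem_preimage, Set.mem_ofPred_eq, ellipticArrangement, Set.sUnion_range,
    Set.mem_iUnion, ellipticProj_mem_iff hω, not_exists, avoidSet]

variable (A b) in
/-- The covering of the complement of the elliptic arrangement. -/
def complementProj {ω : ℂ} (hω : ω.im ≠ 0) (z : avoidSet A b) : Complement ω A b :=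
  ⟨ellipticProj d ω z, (Set.ext_iff.mp (preimage_complement hω) z.1).mpr z.2⟩

theorem isOpenQuotientMap_complementProj {ω : ℂ} (hω : ω.im ≠ 0) :
    IsOpenQuotientMap (complementProj A b hω) :=
  ((isOpenQuotientMap_ellipticProj hω).restrictPreimage
    {z | z ∉ ⋃₀ ellipticArrangement ω A b}).comp
    (Homeomorph.setCongr (preimage_complement hω).symm).isOpenQuotientMap

theorem complementProj_eq_iff {ω : ℂ} (hω : ω.im ≠ 0) {z w : avoidSet A b} :
    complementProj A b hω z = complementProj A b hω w ↔ ∃ v, w.1 = z.1 + pairIntVec v := by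
  rw [← ellipticProj_eq_iff hω]
  exact Subtype.ext_iff

/-! ### The homotopy equivalence -/

section

variable [hA : Fact ((A.map (Int.cast : ℤ → ℝ)).rank = d)] {ω : ℂ} (hω : ω.im ≠ 0)

theorem sum_pairPoint_mem {k : ℕ} {σ : Fin (k + 1) → LiftedPair A b} (hσ : StrictMono σ)
    (t : stdSimplex ℝ (Fin (k + 1))) : ∑ i, t i • pairPoint (σ i).1 ∈ avoidSet A b :=
  faceSystem_pairPoint.sum_mem faceOrder_pairRel mem_avoidSet_of_pairRel hσ t

/-- The map of a point of a simplex to the complement. -/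
def simplexToComplement (x : SimplexUnion (PairCategory A b)) : Complement ω A b :=
  complementProj A b hω
    ⟨∑ i, x.2 i • pairPoint (liftChain x.1.2.1 i).1, sum_pairPoint_mem (strictMono_liftChain x.1.2) x.2⟩

theorem simplexToComplement_eq {x y : SimplexUnion (PairCategory A b)}
    (h : Glue (PairCategory A b) x y) :
    simplexToComplement hω x = simplexToComplement hω y := by
  obtain ⟨γ, i, γ', h, t⟩ := h
  obtain ⟨γ', hγ'⟩ := γ'
  subst h
  obtain ⟨v, hv⟩ := pairPoint_liftChain_chainFace γ.1 i
  refine (complementProj_eq_iff hω).mpr ⟨v, ?_⟩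
  refine (sum_stdSimplex_map_succAbove i t _).trans ?_
  simp_rw [hv, smul_add]
  rw [Finset.sum_add_distrib, ← Finset.sum_smul, stdSimplex.sum_eq_one, one_smul]

theorem continuous_simplexToComplement :
    Continuous (simplexToComplement (A := A) (b := b) hω) := by
  rw [continuous_sigma_iff]
  intro γ
  have h : Continuous fun t : stdSimplex ℝ (Fin (γ.1 + 1)) =>
      ∑ i, t i • pairPoint (liftChain γ.2.1 i).1 := by
    refine continuous_finsetSum _ fun i _ => ?_
    exact ((continuous_apply i).comp continuous_subtype_val).smul continuous_const
  exact (isOpenQuotientMap_complementProj hω).continuous.comp (Continuous.subtype_mk h _)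

/-- The map from the realization to the complement. -/
def realizationMap : C(Realization (PairCategory A b), Complement ω A b) where
  toFun := Quot.lift (simplexToComplement hω) fun _ _ => simplexToComplement_eq hω
  continuous_toFun := continuous_quot_lift _ (continuous_simplexToComplement hω)

/-- The chain `σ` and the normalized lift of its projection differ by the shift of `σ 0`, which the
projection to the complement does not see. -/
theorem realizationMap_realize {k : ℕ} (σ : Fin (k + 1) → LiftedPair A b) (hσ : StrictMono σ)
    (t : stdSimplex ℝ (Fin (k + 1))) : realizationMap hω (realize k σ hσ t) =
      complementProj A b hω ⟨∑ i, t i • pairPoint (σ i).1, sum_pairPoint_mem hσ t⟩ := by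
  refine (complementProj_eq_iff hω).mpr ⟨(σ 0).shift, ?_⟩
  have h : ∀ i, pairPoint (σ i).1 =
      pairPoint (liftChain (projChain σ hσ).1 i).1 + pairIntVec (σ 0).shift := by
    intro i
    have hs : (σ i).shift = (liftChain (projChain σ hσ).1 i).shift + (σ 0).shift := by
      change _ = pairVec ((projChain σ hσ).1.map _) + _
      rw [pairVec_projChain_map, sub_add_cancel]
    rw [pairPoint_eq, pairPoint_eq, add_assoc, ← pairIntVec_add, ← hs]
    rfl
  change ∑ i, t i • pairPoint (σ i).1 =
    ∑ i, t i • pairPoint (liftChain (projChain σ hσ).1 i).1 + pairIntVec (σ 0).shift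
  simp_rw [h, smul_add]
  rw [Finset.sum_add_distrib, ← Finset.sum_smul, stdSimplex.sum_eq_one, one_smul]

/-- The map from the covering of the complement to the realization. -/
def liftedRetraction : C(avoidSet A b, Realization (PairCategory A b)) where
  toFun := faceSystem_pairPoint.desc faceOrder_pairRel mem_avoidSet_of_pairRel realize
  continuous_toFun := faceSystem_pairPoint.continuous_desc faceOrder_pairRel
    mem_avoidSet_of_pairRel isChainMap_realize

variable (A b) in
/-- The retraction of the covering of the complement onto a union of simplices. -/
def pairRetract (x : (Fin d → ℝ) × (Fin d → ℝ)) : (Fin d → ℝ) × (Fin d → ℝ) :=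
  faceSystem_pairPoint.retract (faceOrder_pairRel (A := A) (b := b)) (avoidSet A b) x

theorem liftedRetraction_add (x : avoidSet A b) (v : (Fin d → ℤ) × (Fin d → ℤ)) :
    liftedRetraction ⟨x.1 + pairIntVec v, (add_mem_avoidSet_iff v _).mpr x.2⟩ = liftedRetraction x ∧
      pairRetract A b (x + pairIntVec v) = pairRetract A b x + pairIntVec v :=
  faceSystem_pairPoint.desc_add faceOrder_pairRel mem_avoidSet_of_pairRel isChainMap_realize
    (add_mem_avoidSet_iff v) (translate_strictMono v) (pairPoint_translate v)
    (fun k σ hσ t => realize_translate v k σ hσ t _ _ fun _ => rfl) x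

theorem liftedRetraction_factorsThrough (x y : avoidSet A b)
    (h : complementProj A b hω x = complementProj A b hω y) :
    liftedRetraction x = liftedRetraction y := by
  obtain ⟨v, hv⟩ := (complementProj_eq_iff hω).mp h
  rw [← (liftedRetraction_add x v).1]
  congr 1
  exact Subtype.ext hv.symm

/-- The projection of the covering, as a bundled continuous map. -/
def complementProjMap : C(avoidSet A b, Complement ω A b) :=
  ⟨complementProj A b hω, (isOpenQuotientMap_complementProj hω).continuous⟩

/-- The map from the complement to the realization. -/
def complementMap : C(Complement ω A b, Realization (PairCategory A b)) :=
  (show IsQuotientMap (complementProjMap (A := A) (b := b) hω) from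
    (isOpenQuotientMap_complementProj hω).isQuotientMap).lift liftedRetraction
    fun x y h => liftedRetraction_factorsThrough hω x y h

theorem complementMap_complementProj (x : avoidSet A b) :
    complementMap hω (complementProj A b hω x) = liftedRetraction x :=
  DFunLike.congr_fun ((show IsQuotientMap (complementProjMap (A := A) (b := b) hω) from
    (isOpenQuotientMap_complementProj hω).isQuotientMap).lift_comp liftedRetraction
    fun x y h => liftedRetraction_factorsThrough hω x y h) x

/-- Points of simplices with all vertices in `avoidSet A b` are not moved by the truncation. -/
theorem complementMap_comp_realizationMap :
    (complementMap hω).comp (realizationMap (A := A) (b := b) hω) = ContinuousMap.id _ := by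
  ext x
  induction x using Quot.ind with
  | _ x =>
    obtain ⟨⟨k, γ⟩, t⟩ := x
    have h1 : liftedRetraction ⟨∑ i, t i • pairPoint (liftChain γ.1 i).1,
        sum_pairPoint_mem (strictMono_liftChain γ) t⟩ =
        realize k (liftChain γ.1) (strictMono_liftChain γ) t :=
      faceSystem_pairPoint.desc_sum faceOrder_pairRel mem_avoidSet_of_pairRel isChainMap_realize
        (strictMono_liftChain γ) t _
    rw [realize, projChain_liftChain] at h1
    exact (complementMap_complementProj hω _).trans h1

theorem realizationMap_liftedRetraction (x : avoidSet A b) :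
    realizationMap hω (liftedRetraction x) = complementProj A b hω ⟨pairRetract A b x,
      faceSystem_pairPoint.retract_mem faceOrder_pairRel mem_avoidSet_of_pairRel x⟩ := by
  obtain ⟨k, σ, hσ, t, -, h1, h2⟩ := faceSystem_pairPoint.exists_desc_eq faceOrder_pairRel
    mem_avoidSet_of_pairRel isChainMap_realize x
  refine (congrArg (realizationMap hω) h1).trans ((realizationMap_realize hω σ hσ t).trans ?_)
  exact congrArg _ (Subtype.ext h2.symm)

/-- The straight-line homotopy on the covering, followed by the projection. -/
def liftedHomotopy : C(unitInterval × avoidSet A b, Complement ω A b) where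
  toFun x := complementProj A b hω ⟨(1 - (x.1 : ℝ)) • x.2.1 + (x.1 : ℝ) • pairRetract A b x.2,
    faceSystem_pairPoint.segment_mem faceOrder_pairRel mem_avoidSet_of_pairRel x.2 x.1.2.1 x.1.2.2⟩
  continuous_toFun := by
    have h := faceSystem_pairPoint.continuous_retract (faceOrder_pairRel (A := A) (b := b))
      mem_avoidSet_of_pairRel
    have h' : Continuous fun x : unitInterval × avoidSet A b => pairRetract A b x.2 :=
      h.comp continuous_snd
    refine (isOpenQuotientMap_complementProj hω).continuous.comp (Continuous.subtype_mk ?_ _)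
    fun_prop

theorem liftedHomotopy_factorsThrough (x y : unitInterval × avoidSet A b)
    (h : Prod.map id (complementProj A b hω) x = Prod.map id (complementProj A b hω) y) :
    liftedHomotopy hω x = liftedHomotopy hω y := by
  obtain ⟨s, x⟩ := x
  obtain ⟨s', y⟩ := y
  obtain ⟨h1, h2⟩ := Prod.ext_iff.mp h
  change s = s' at h1
  subst h1
  obtain ⟨v, hv⟩ := (complementProj_eq_iff hω).mp h2
  refine (complementProj_eq_iff hω).mpr ⟨v, ?_⟩
  simp only
  -- Both ends of the segment are translated by the same vector, hence so is each of its points.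
  rw [hv, (liftedRetraction_add x v).2]
  module

theorem realizationMap_comp_complementMap :
    ((realizationMap (A := A) (b := b) hω).comp (complementMap hω)).Homotopic
      (ContinuousMap.id _) := by
  -- The product with the interval is again an open quotient map, so the homotopy upstairs descends
  -- to a continuous one.
  have hq : IsOpenQuotientMap (Prod.map (id : unitInterval → unitInterval)
      (complementProj A b hω)) :=
    IsOpenQuotientMap.id.prodMap (isOpenQuotientMap_complementProj hω)
  have hq' : IsQuotientMap (⟨_, hq.continuous⟩ :
    C(unitInterval × avoidSet A b, unitInterval × Complement ω A b)) := hq.isQuotientMap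
  have hfac : Function.FactorsThrough (liftedHomotopy (A := A) (b := b) hω)
      (⟨_, hq.continuous⟩ : C(unitInterval × avoidSet A b, unitInterval × Complement ω A b)) :=
    fun x y h => liftedHomotopy_factorsThrough hω x y h
  have hval : ∀ (s : unitInterval) (x : avoidSet A b),
      hq'.lift (liftedHomotopy hω) hfac (s, complementProj A b hω x) = liftedHomotopy hω (s, x) :=
    fun s x => DFunLike.congr_fun (hq'.lift_comp (liftedHomotopy hω) hfac) (s, x)
  refine ContinuousMap.Homotopic.symm ⟨⟨hq'.lift (liftedHomotopy hω) hfac, fun z => ?_,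
    fun z => ?_⟩⟩
  · obtain ⟨x, rfl⟩ := (isOpenQuotientMap_complementProj hω).surjective z
    refine (hval 0 x).trans (congrArg (complementProj A b hω) (Subtype.ext ?_))
    simp
  · obtain ⟨x, rfl⟩ := (isOpenQuotientMap_complementProj hω).surjective z
    refine (hval 1 x).trans ?_
    rw [ContinuousMap.comp_apply, complementMap_complementProj, realizationMap_liftedRetraction]
    refine congrArg (complementProj A b hω) (Subtype.ext ?_)
    simp

end

end EllipticArrangement

end

theorem mainTheorem1 (ω : ℂ) (hω : ω.im ≠ 0) (d n : ℕ)
    (A : Matrix (Fin d) (Fin n) ℤ) (hA : (A.map (Int.cast : ℤ → ℝ)).rank = d)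
    (b : Fin n → UnitAddCircle) :
    EllipticArrangement.IsAcyclicCategory (EllipticArrangement.PairCategory A b) ∧
    Nonempty (EllipticArrangement.Realization (EllipticArrangement.PairCategory A b) ≃ₕ
      EllipticArrangement.Complement ω A b) := by
  have : Fact ((A.map (Int.cast : ℤ → ℝ)).rank = d) := ⟨hA⟩
  refine ⟨EllipticArrangement.isAcyclicCategory_pairCategory, ⟨⟨EllipticArrangement.realizationMap hω,
    EllipticArrangement.complementMap hω, ?_, ?_⟩⟩⟩
  · rw [EllipticArrangement.complementMap_comp_realizationMap]
  · exact EllipticArrangement.realizationMap_comp_complementMap hω
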